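/- **Setting.** Let $d\ge 1$. For $i=0,\dots,d$ let $\rho_i:\mathbb{R}\to[0,\infty)$ be a probability density with $\mathrm{supp}(\rho_i)=\mathbb{R}$ and let $\psi_i:\mathbb{R}\to(0,\infty)$ be integrable; let $\Phi_0$ be the distribution function of $\rho_0$. Let $\gamma_{\mathfrak u}>0$ for $\mathfrak u\subseteq\{0,\dots,d\}$, with $\gamma_\emptyset=1$. For a multi-index $\eta$ in the variables $y_0,\dots,y_d$ (or $y_1,\dots,y_d$) put $|\eta|=\sum_i\eta_i$, $\gamma_\eta=\gamma_{\{i:\eta_i\ne0\}}$, $D^\eta=\prod_i\partial^{\eta_i}/\partial y_i^{\eta_i}$ and $w_\eta(y)=\prod_{\eta_i\ne0}\psi_i(y_i)\prod_{\eta_i=0}\rho_i(y_i)$. With $n=d+1$ for the variables $y_0,\dots,y_d$ and $n=d$ for the variables $y_1,\dots,y_d$, let $C^{\nu}(\mathbb{R}^{n})$ be the space of functions whose mixed derivatives $D^\eta g$, $\eta\le\nu$ (componentwise), are continuous, and let $\mathcal H^\nu_n$ be the space of locally integrable functions $g$ with weak derivatives $D^\eta g$, $\eta\le\nu$, for which $$\|g\|_{\mathcal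 H^\nu_n}^2=\sum_{\eta\le\nu}\frac1{\gamma_\eta}\int_{\mathbb{R}^n}|D^\eta g(y)|^2\,w_\eta(y)\,dy<\infty .$$ Let $e_0$ be the multi-index $(1,0,\dots,0)$ and $D^0=\partial/\partial y_0$. **Assumptions.** Let $\nu\in\mathbb{N}_0^d$, $[a,b]\subset\mathbb{R}$, $\rho_0\in C^{|\nu|}(\mathbb{R})$, and let $\phi:\mathbb{R}^{d+1}\to\mathbb{R}$ satisfy $D^0\phi>0$ everywhere, $\phi(y_0,y)\to\infty$ as $y_0\to\infty$ for every $y\in\mathbb{R}^d$, and $\phi\in\mathcal H^{(|\nu|+1,\nu)}_{d+1}\cap C^{(|\nu|+1,\nu)}(\mathbb{R}^{d+1})$. For $t\in[a,b]$ let $U_t=\{y\in\mathbb{R}^d:\phi(y_0,y)=t\text{ for some }y_0\in\mathbb{R}\}$, and for $y\in U_t$ let $\xi(t,y)$ be the unique real number with $\phi(\xi(t,y),y)=t$. Suppose that for every $0\ne\eta\le\nu$ there is a constant $B_{0,\eta}<\infty$ such that every function of the form $$h(t,y)=\frac{(-1)^r\,\rho_0^{(\beta)}(\xi(t,y))\,\prod_{\ell=1}^rD^{\alpha_\ell}\phi(\xi(t,y),y)}{[D^0\phi(\xi(t,y),y)]^{r}},$$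 where $r,\beta\in\mathbb{N}_0$, $\alpha_\ell\in\mathbb{N}_0^{d+1}\setminus\{e_0,0\}$, $r\le2|\eta|-1$, $\alpha_{\ell,0}\le|\eta|$, $\beta\le|\eta|-1$ and $\beta e_0+\sum_{\ell=1}^r\alpha_\ell=(r-1,\eta)$, satisfies $h(t,y)\to0$ as $y\in U_t$ tends to any point of $\partial U_t$, for all $t\in[a,b]$, and $$\sup_{t\in[a,b]}\int_{U_t}|h(t,y)|^2\,w_\eta(y)\,dy\le B_{0,\eta}.$$ **Conclusion.** For every $t\in[a,b]$ the preintegrated indicator $$P_0g_t(y)=\int_{-\infty}^\infty \mathrm{ind}(t-\phi(y_0,y))\,\rho_0(y_0)\,dy_0,\qquad \mathrm{ind}(z)=1\text{ if }z\ge0,\ \mathrm{ind}(z)=0\text{ if }z<0,$$ is equal to $\Phi_0(\xi(t,y))$ for $y\in U_t$ and to $0$ for $y\notin U_t$, it lies in $\mathcal H^\nu_d\cap C^\nu(\mathbb{R}^d)$, and $$\sup_{t\in[a,b]}\|P_0g_t\|_{\mathcal H^\nu_d}\le\Bigg(1+\sum_{0\ne\eta\le\nu}\frac{\big(8^{|\eta|-1}(|\eta|-1)!\big)^2B_{0,\eta}}{\gamma_\eta}\Bigg)^{1/2}<\infty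 .$$ -/

import Mathlib

open MeasureTheory Filter Topology
open scoped ENNReal NNReal ContDiff

noncomputable section

namespace Preint

/-! ### Multi-indices and mixed partial derivatives on `ℝⁿ = (Fin n → ℝ)` -/

/-- The order `|η|` of a multi-index. -/
def order {n : ℕ} (η : Fin n → ℕ) : ℕ := ∑ i, η i

/-- The support of a multi-index. -/
def supp {n : ℕ} (η : Fin n → ℕ) : Finset (Fin n) := Finset.univ.filter fun i => η i ≠ 0

/-- The `i`-th unit multi-index. -/
def unit {n : ℕ} (i : Fin n) : Fin n → ℕ := Pi.single i 1

/-- The first-order partial derivative `D^i = ∂/∂yᵢ`. -/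
def partialDeriv {n : ℕ} (i : Fin n) (f : (Fin n → ℝ) → ℝ) : (Fin n → ℝ) → ℝ :=
  fun y => lineDeriv ℝ f y (Pi.single i 1)

/-- The mixed derivative `D^η = ∏ᵢ ∂^{ηᵢ}/∂yᵢ^{ηᵢ}` (the factor with the smallest `i` is applied
last). -/
def mixedDeriv {n : ℕ} (η : Fin n → ℕ) (f : (Fin n → ℝ) → ℝ) : (Fin n → ℝ) → ℝ :=
  (List.finRange n).foldr (fun i g => (partialDeriv i)^[η i] g) f

/-- The space `C^ν(ℝⁿ)` of functions with continuous mixed derivatives `D^η`, `η ≤ ν`. The second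
clause says that the derivatives really exist (so that no default value of a derivative is met) and
that the order in which the partial derivatives are taken is immaterial. -/
def mixedC {n : ℕ} (ν : Fin n → ℕ) : Set ((Fin n → ℝ) → ℝ) :=
  {g | (∀ η ≤ ν, Continuous (mixedDeriv η g)) ∧
    ∀ (η : Fin n → ℕ) (i : Fin n), η + unit i ≤ ν →
      ∀ y, HasLineDerivAt ℝ (mixedDeriv η g) (mixedDeriv (η + unit i) g y) y (Pi.single i 1)}

/-- The locally integrable function `w` is the `η`-th weak derivative of `g`. -/
def HasWeakDeriv {n : ℕ} (η : Fin n → ℕ) (g w : (Fin n → ℝ) → ℝ) : Prop :=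
  LocallyIntegrable w ∧
    ∀ v : (Fin n → ℝ) → ℝ, ContDiff ℝ ∞ v → HasCompactSupport v →
      ∫ y, w y * v y = (-1) ^ order η * ∫ y, g y * mixedDeriv η v y

/-- Weak derivatives are unique almost everywhere. -/
theorem HasWeakDeriv.ae_eq {n : ℕ} {η : Fin n → ℕ} {g w₁ w₂ : (Fin n → ℝ) → ℝ}
    (h₁ : HasWeakDeriv η g w₁) (h₂ : HasWeakDeriv η g w₂) : w₁ =ᵐ[volume] w₂ := by
  refine ae_eq_of_integral_contDiff_smul_eq h₁.1 h₂.1 fun v hv hc => ?_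
  simp only [smul_eq_mul, mul_comm (v _)]
  rw [h₁.2 v hv hc, h₂.2 v hv hc]

/-! ### Weights and Sobolev spaces of dominating mixed smoothness -/

/-- A probability density on `ℝ` whose support is all of `ℝ`. -/
structure IsDensity (ρ : ℝ → ℝ) : Prop where
  nonneg : ∀ x, 0 ≤ ρ x
  integrable : Integrable ρ
  integral_eq_one : ∫ x, ρ x = 1
  tsupport_eq : tsupport ρ = Set.univ

/-- The distribution function of a density. -/
def distFun (ρ : ℝ → ℝ) (x : ℝ) : ℝ := ∫ z in Set.Iic x, ρ z

/-- The data that determine the weighted spaces in `n` variables: a density `ρᵢ` and a strictly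
positive integrable weight function `ψᵢ` for every variable, and positive weight parameters `γ_u`
for the sets `u` of variables, with `γ_∅ = 1`. -/
structure Weights (n : ℕ) where
  ρ : Fin n → ℝ → ℝ
  ψ : Fin n → ℝ → ℝ
  γ : Finset (Fin n) → ℝ
  density : ∀ i, IsDensity (ρ i)
  ψ_pos : ∀ i x, 0 < ψ i x
  ψ_integrable : ∀ i, Integrable (ψ i)
  γ_pos : ∀ u, 0 < γ u
  γ_empty : γ ∅ = 1

/-- The data for the variables `y₁, …, y_d`, obtained by leaving out the variable `y₀`. -/
def Weights.tail {d : ℕ} (W : Weights (d + 1)) : Weights d where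
  ρ i := W.ρ i.succ
  ψ i := W.ψ i.succ
  γ u := W.γ (u.map (Fin.succEmb d))
  density i := W.density i.succ
  ψ_pos i := W.ψ_pos i.succ
  ψ_integrable i := W.ψ_integrable i.succ
  γ_pos u := W.γ_pos _
  γ_empty := by simpa using W.γ_empty

/-- The weight `ψ_η(y_η) ρ_{-η}(y_{-η}) = ∏_{ηᵢ ≠ 0} ψᵢ(yᵢ) ∏_{ηᵢ = 0} ρᵢ(yᵢ)`. -/
def Weights.weight {n : ℕ} (W : Weights n) (η : Fin n → ℕ) (y : Fin n → ℝ) : ℝ :=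
  ∏ i, if η i = 0 then W.ρ i (y i) else W.ψ i (y i)

/-- `∫_A |w(y)|² ψ_η(y_η) ρ_{-η}(y_{-η}) dy`, as an element of `[0, ∞]`. -/
def Weights.energy {n : ℕ} (W : Weights n) (η : Fin n → ℕ) (A : Set (Fin n → ℝ))
    (w : (Fin n → ℝ) → ℝ) : ℝ≥0∞ :=
  ∫⁻ y in A, ENNReal.ofReal (|w y| ^ 2 * W.weight η y)

/-- `∫_{ℝⁿ} |D^η g(y)|² ψ_η(y_η) ρ_{-η}(y_{-η}) dy` with the weak derivative `D^η g`, and `∞` if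
`g` has no `η`-th weak derivative. The infimum only serves to pick the weak derivative, which is
unique up to null sets; see `derivEnergy_eq`. -/
def Weights.derivEnergy {n : ℕ} (W : Weights n) (η : Fin n → ℕ) (g : (Fin n → ℝ) → ℝ) : ℝ≥0∞ :=
  ⨅ (w : (Fin n → ℝ) → ℝ) (_ : HasWeakDeriv η g w), W.energy η Set.univ w

theorem Weights.derivEnergy_eq {n : ℕ} (W : Weights n) {η : Fin n → ℕ} {g w : (Fin n → ℝ) → ℝ}
    (hw : HasWeakDeriv η g w) : W.derivEnergy η g = W.energy η Set.univ w := by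
  refine le_antisymm (iInf₂_le w hw) (le_iInf₂ fun w' hw' => le_of_eq ?_)
  unfold Weights.energy
  refine lintegral_congr_ae (ae_restrict_of_ae ?_)
  filter_upwards [hw.ae_eq hw'] with y hy
  rw [hy]

/-- The norm of the Sobolev space of dominating mixed smoothness of order `ν`,
`‖g‖² = ∑_{η ≤ ν} γ_η⁻¹ ∫ |D^η g|² ψ_η ρ_{-η}`, as an element of `[0, ∞]`. -/
def Weights.sobolevNorm {n : ℕ} (W : Weights n) (ν : Fin n → ℕ) (g : (Fin n → ℝ) → ℝ) : ℝ≥0∞ :=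
  (∑ η ∈ Finset.Iic ν, ENNReal.ofReal (1 / W.γ (supp η)) * W.derivEnergy η g) ^ (1 / 2 : ℝ)

/-- The Sobolev space `H^ν_n` of dominating mixed smoothness of order `ν`. -/
def Weights.sobolev {n : ℕ} (W : Weights n) (ν : Fin n → ℕ) : Set ((Fin n → ℝ) → ℝ) :=
  {g | LocallyIntegrable g ∧ W.sobolevNorm ν g < ⊤}

/-! ### Preintegration -/

/-- The indicator function of `[0, ∞)`. -/
def ind (z : ℝ) : ℝ := if 0 ≤ z then 1 else 0

/-- Preintegration with respect to the variable `y₀` with density `ρ₀`; the point `(y₀, y)` of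
`ℝ^{d+1}` is `Fin.cons y₀ y`. -/
def preintegrate {d : ℕ} (ρ₀ : ℝ → ℝ) (g : (Fin (d + 1) → ℝ) → ℝ) : (Fin d → ℝ) → ℝ :=
  fun y => ∫ y₀ : ℝ, g (Fin.cons y₀ y) * ρ₀ y₀

/-- Monotonicity, growth and smoothness of `φ`, and smoothness of `ρ₀`. -/
structure SmoothMonotone {d : ℕ} (W : Weights (d + 1)) (ν : Fin d → ℕ)
    (φ : (Fin (d + 1) → ℝ) → ℝ) : Prop where
  deriv_pos : ∀ x, 0 < partialDeriv 0 φ x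
  tendsto_atTop : ∀ y : Fin d → ℝ, Tendsto (fun y₀ : ℝ => φ (Fin.cons y₀ y)) atTop atTop
  mem : φ ∈ W.sobolev (Fin.cons (order ν + 1) ν) ∩ mixedC (Fin.cons (order ν + 1) ν)
  contDiff : ContDiff ℝ (order ν) (W.ρ 0)

/-- `U_t`, the set of all `y` for which `φ(·, y)` takes the value `t`. -/
def levelDomain {d : ℕ} (φ : (Fin (d + 1) → ℝ) → ℝ) (t : ℝ) : Set (Fin d → ℝ) :=
  {y | ∃ y₀ : ℝ, φ (Fin.cons y₀ y) = t}

/-- `ξ(t, y)`: for `y ∈ U_t` the real number with `φ(ξ(t, y), y) = t` (unique if `φ` is strictly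
increasing in `y₀`). It is only used for `y ∈ U_t`. -/
def xi {d : ℕ} (φ : (Fin (d + 1) → ℝ) → ℝ) (t : ℝ) (y : Fin d → ℝ) : ℝ :=
  Classical.epsilon fun y₀ : ℝ => φ (Fin.cons y₀ y) = t

/-- The index triples `(r, α, β)` of the functions `h_{q,η}`:
`α_ℓ ∉ {0, e₀}`, `r ≤ 2|η| + q - 1`, `α_{ℓ,0} ≤ |η| + q`, `β ≤ |η| + q - 1` and
`β e₀ + ∑_ℓ α_ℓ = (r + q - 1, η)`. The subtractions of `1` are moved to the other side, so that
they mean subtraction of integers. -/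
structure Admissible {d : ℕ} (q : ℕ) (η : Fin d → ℕ) (r : ℕ) (α : Fin r → Fin (d + 1) → ℕ)
    (β : ℕ) : Prop where
  ne_zero : ∀ l, α l ≠ 0
  ne_unit : ∀ l, α l ≠ unit 0
  r_le : r + 1 ≤ 2 * order η + q
  α_zero_le : ∀ l, α l 0 ≤ order η + q
  β_le : β + 1 ≤ order η + q
  sum_zero : β + (∑ l, α l 0) + 1 = r + q
  sum_succ : ∀ i : Fin d, ∑ l, α l i.succ = η i

/-- The function `h_{q,η,(r,α,β)}(t, y)`, which is
`(-1)^r ρ₀^{(β)}(ξ) ∏_{ℓ=1}^r D^{α_ℓ} φ(ξ, y) / [D⁰ φ(ξ, y)]^{r+q}` with `ξ = ξ(t, y)`. -/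
def hFun {d : ℕ} (φ : (Fin (d + 1) → ℝ) → ℝ) (ρ₀ : ℝ → ℝ) (q r : ℕ)
    (α : Fin r → Fin (d + 1) → ℕ) (β : ℕ) (t : ℝ) (y : Fin d → ℝ) : ℝ :=
  (-1) ^ r * iteratedDeriv β ρ₀ (xi φ t y) *
      (∏ l, mixedDeriv (α l) φ (Fin.cons (xi φ t y) y)) /
    partialDeriv 0 φ (Fin.cons (xi φ t y) y) ^ (r + q)

/-- The boundary and integrability conditions on all functions `h_{q,η}`, with the constant
`B = B_{q,η}`. -/
structure HCondition {d : ℕ} (W : Weights (d + 1)) (φ : (Fin (d + 1) → ℝ) → ℝ) (a b : ℝ)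
    (q : ℕ) (η : Fin d → ℕ) (B : ℝ≥0) : Prop where
  tendsto_boundary : ∀ (r : ℕ) (α : Fin r → Fin (d + 1) → ℕ) (β : ℕ), Admissible q η r α β →
    ∀ t ∈ Set.Icc a b, ∀ z ∈ frontier (levelDomain φ t),
      Tendsto (hFun φ (W.ρ 0) q r α β t) (𝓝[levelDomain φ t] z) (𝓝 0)
  integral_le : ∀ (r : ℕ) (α : Fin r → Fin (d + 1) → ℕ) (β : ℕ), Admissible q η r α β →
    (⨆ t ∈ Set.Icc a b,
      W.tail.energy η (levelDomain φ t) (hFun φ (W.ρ 0) q r α β t)) ≤ (B : ℝ≥0∞)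

end Preint

end

noncomputable section

namespace Preint

/-! ### Extension of derivatives by zero -/

/-! For `y ∈ U_t`, monotonicity turns the integrand into `ρ₀` cut off at `ξ(t, y)`, so the
preintegrated indicator is `Φ₀ ∘ ξ`. For `y ∉ U_t`, the growth of `φ` leaves only `φ(·, y) > t`, so
it is `0`. At a boundary point of `U_t`, `ξ → -∞` and `Φ₀(ξ) → 0`; the two pieces join continuously.

Inside `U_t`, implicit differentiation gives `∂ᵢξ = -Dⁱφ / D⁰φ`. Hence `∂ᵢ(Φ₀ ∘ ξ)` is a single
function `h` with `r = 1`, and the class of functions `h` is closed under differentiation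
(`SmoothMonotone.hasLineDerivAt_hFun`): the chain, product and quotient rules turn one `h` of order
`η` into `1 + 4r ≤ 8|η|` functions `h` of order `η + eᵢ`. By induction a derivative of order `k ≥ 1`
is a sum of at most `8^{k-1} (k-1)!` such functions.

The passage to all of `ℝ^d` rests on `hasLineDerivAt_of_extend_zero`. Each derivative, extended by
zero, is continuous because every `h` vanishes at the boundary, and by the mean value theorem it is
then the derivative of the previous extension everywhere (`SmoothMonotone.exists_isTermDeriv_step`).
Integration by parts makes these functions weak derivatives. A continuous weak derivative is unique,
so the order of differentiation does not matter, which gives membership in `C^ν`.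

For the norm, the term `η = 0` is at most `1`, since the function has values in `[0, 1]` and its
weight is a probability density. The others follow from Cauchy–Schwarz applied to a sum of `N`
terms, each of energy at most `B_{0,η}`, which gives `N² B_{0,η}`. -/

theorem abs_le_mul_of_hasDerivAt_off_zero {F G : ℝ → ℝ} {V : Set ℝ} (hF : Continuous F)
    (hF0 : ∀ s ∉ V, F s = 0) (hV : ∀ s ∈ V, HasDerivAt F (G s) s) {s₀ s C : ℝ} (hC : 0 ≤ C)
    (hs₀ : s₀ ∉ V) (hs : s₀ ≤ s) (hVo : IsOpen V) (hb : ∀ u ∈ Set.Icc s₀ s, |G u| ≤ C) :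
    |F s| ≤ C * (s - s₀) := by
  by_cases hsV : s ∈ V
  -- The point `c` is the last one of `[s₀, s]` outside `V`. There `F` vanishes, and the mean value
  -- theorem applies on `(c, s) ⊆ V`, however complicated `V` is to the left of `c`.
  · set K : Set ℝ := Set.Icc s₀ s ∩ Vᶜ
    have hKc : IsCompact K := isCompact_Icc.inter_right hVo.isClosed_compl
    have hKn : K.Nonempty := ⟨s₀, ⟨le_rfl, hs⟩, hs₀⟩
    obtain ⟨⟨hc1, hc2⟩, hcV⟩ := hKc.sSup_mem hKn
    set c := sSup K
    have hcs : c < s := lt_of_le_of_ne hc2 fun h => hcV (h ▸ hsV)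
    have hin : ∀ u ∈ Set.Ioo c s, u ∈ V := fun u hu => by
      by_contra h
      exact absurd (le_csSup hKc.bddAbove ⟨⟨hc1.trans hu.1.le, hu.2.le⟩, h⟩) (not_le.2 hu.1)
    obtain ⟨x, hx, hxe⟩ := exists_hasDerivAt_eq_slope F G hcs hF.continuousOn
      fun u hu => hV u (hin u hu)
    rw [hF0 c hcV, sub_zero, eq_div_iff (by linarith)] at hxe
    rw [← hxe, abs_mul, abs_of_pos (by linarith : 0 < s - c)]
    exact mul_le_mul (hb x ⟨by linarith [hx.1], hx.2.le⟩) (by linarith) (by linarith) hC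
  · rw [hF0 s hsV, abs_zero]
    exact mul_nonneg hC (by linarith)

/-- Only points `s₀ ∉ V` need an argument. There `G s₀ = 0`, so `|G| ≤ ε` near `s₀` by continuity,
and the mean value estimate gives `|F s| ≤ ε |s - s₀|`. -/
theorem hasDerivAt_of_extend_zero {F G : ℝ → ℝ} {V : Set ℝ} (hVo : IsOpen V)
    (hF : Continuous F) (hG : Continuous G) (hF0 : ∀ s ∉ V, F s = 0) (hG0 : ∀ s ∉ V, G s = 0)
    (hV : ∀ s ∈ V, HasDerivAt F (G s) s) (s₀ : ℝ) : HasDerivAt F (G s₀) s₀ := by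
  by_cases h₀ : s₀ ∈ V
  · exact hV s₀ h₀
  rw [hG0 s₀ h₀, hasDerivAt_iff_isLittleO, Asymptotics.isLittleO_iff]
  intro ε hε
  have := Metric.continuous_iff.1 hG s₀ ε hε
  obtain ⟨δ, hδ, hd⟩ := this
  filter_upwards [Metric.ball_mem_nhds s₀ hδ] with s hs
  rw [Metric.mem_ball, Real.dist_eq, abs_lt] at hs
  simp only [hF0 s₀ h₀, sub_zero, smul_zero, Real.norm_eq_abs]
  have hd' : ∀ u, |u - s₀| < δ → |G u| ≤ ε := fun u hu => by
    have := hd u (by rwa [Real.dist_eq])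
    rw [hG0 s₀ h₀, Real.dist_eq, sub_zero] at this
    exact this.le
  rcases le_total s₀ s with h | h
  · rw [abs_of_nonneg (by linarith : 0 ≤ s - s₀)]
    exact abs_le_mul_of_hasDerivAt_off_zero hF hF0 hV hε.le h₀ h hVo
      fun u hu => hd' u (by rw [abs_lt]; constructor <;> linarith [hu.1, hu.2])
  -- The left side is reduced to the right side by the reflection `u ↦ -u`.
  · have := abs_le_mul_of_hasDerivAt_off_zero (F := fun u => F (-u)) (G := fun u => -G (-u))
      (V := Neg.neg ⁻¹' V) (s₀ := -s₀) (s := -s) (by fun_prop) (fun u hu => hF0 _ hu)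
      (fun u hu => by
        have := (hV (-u) hu).comp u (hasDerivAt_neg u)
        simpa [Function.comp_def] using this) hε.le (by simpa using h₀) (by linarith)
      (hVo.preimage continuous_neg)
      (fun u hu => by
        rw [abs_neg]
        exact hd' _ (by rw [abs_lt]; constructor <;> linarith [hu.1, hu.2]))
    rw [neg_neg] at this
    rw [abs_of_nonpos (by linarith : s - s₀ ≤ 0)]
    linarith

theorem hasDerivAt_line_of_hasLineDerivAt {n : ℕ} {f : (Fin n → ℝ) → ℝ} {f' : ℝ} {y e : Fin n → ℝ}
    {s : ℝ} (h : HasLineDerivAt ℝ f f' (y + s • e) e) :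
    HasDerivAt (fun u => f (y + u • e)) f' s := by
  unfold HasLineDerivAt at h
  have h2 : HasDerivAt (fun u : ℝ => u - s) 1 s := (hasDerivAt_id s).sub_const s
  have := HasDerivAt.comp s (h₂ := fun t : ℝ => f (y + s • e + t • e)) (h := fun u => u - s)
    (by simpa using h) h2
  rw [mul_one] at this
  refine this.congr_of_eventuallyEq (Eventually.of_forall fun u => ?_)
  simp only [Function.comp]
  rw [add_assoc, ← add_smul, add_sub_cancel]

theorem hasLineDerivAt_of_extend_zero {n : ℕ} {F G : (Fin n → ℝ) → ℝ} {U : Set (Fin n → ℝ)}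
    {e : Fin n → ℝ} (hU : IsOpen U) (hF : Continuous F) (hG : Continuous G)
    (hF0 : ∀ y ∉ U, F y = 0) (hG0 : ∀ y ∉ U, G y = 0)
    (hd : ∀ y ∈ U, HasLineDerivAt ℝ F (G y) y e) (y : Fin n → ℝ) :
    HasLineDerivAt ℝ F (G y) y e := by
  have hc : Continuous fun s : ℝ => y + s • e := by fun_prop
  have := hasDerivAt_of_extend_zero (F := fun s : ℝ => F (y + s • e))
    (G := fun s : ℝ => G (y + s • e)) (hU.preimage hc) (hF.comp hc) (hG.comp hc)
    (fun s hs => hF0 _ hs) (fun s hs => hG0 _ hs) 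
    (fun s hs => hasDerivAt_line_of_hasLineDerivAt (hd _ hs)) 0
  simpa [HasLineDerivAt] using this

/-- A function which is continuous on an open set, tends to zero at its boundary points and
vanishes outside is continuous. -/
theorem continuous_of_extend_zero {X : Type*} [TopologicalSpace X] {U : Set X} {G : X → ℝ}
    (hU : IsOpen U) (hc : ContinuousOn G U) (h0 : ∀ y ∉ U, G y = 0)
    (hb : ∀ z ∈ frontier U, Tendsto G (𝓝[U] z) (𝓝 0)) : Continuous G := by
  rw [continuous_iff_continuousAt]
  intro y
  by_cases hy : y ∈ U
  · exact hc.continuousAt (hU.mem_nhds hy)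
  · have hc' : Tendsto G (𝓝[Uᶜ] y) (𝓝 0) :=
      tendsto_const_nhds.congr' (by filter_upwards [self_mem_nhdsWithin] with z hz using (h0 z hz).symm)
    have hi : Tendsto G (𝓝[U] y) (𝓝 0) := by
      by_cases hcl : y ∈ closure U
      · exact hb y ⟨hcl, by rwa [hU.interior_eq]⟩
      · rw [mem_closure_iff_nhdsWithin_neBot, not_neBot] at hcl
        rw [hcl]
        exact tendsto_bot
    rw [ContinuousAt, h0 y hy, ← nhdsWithin_univ, ← Set.union_compl_self U, nhdsWithin_union]
    exact hi.sup hc'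

/-! ### Partial derivatives of smooth functions -/

theorem partialDeriv_eq_fderiv {n : ℕ} {v : (Fin n → ℝ) → ℝ} (hv : ContDiff ℝ ∞ v) (i : Fin n) :
    partialDeriv i v = fun y => fderiv ℝ v y (Pi.single i 1) := by
  funext y
  exact ((hv.differentiable (by simp)) y).lineDeriv_eq_fderiv

theorem contDiff_partialDeriv {n : ℕ} {v : (Fin n → ℝ) → ℝ} (hv : ContDiff ℝ ∞ v) (i : Fin n) :
    ContDiff ℝ ∞ (partialDeriv i v) := by
  rw [partialDeriv_eq_fderiv hv]
  exact (hv.fderiv_right (by simp)).clm_apply contDiff_const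

theorem hasCompactSupport_partialDeriv {n : ℕ} {v : (Fin n → ℝ) → ℝ} (hv : ContDiff ℝ ∞ v)
    (hc : HasCompactSupport v) (i : Fin n) : HasCompactSupport (partialDeriv i v) := by
  rw [partialDeriv_eq_fderiv hv]
  exact hc.fderiv_apply ℝ _

theorem partialDeriv_comm {n : ℕ} {v : (Fin n → ℝ) → ℝ} (hv : ContDiff ℝ ∞ v) (i j : Fin n) :
    partialDeriv i (partialDeriv j v) = partialDeriv j (partialDeriv i v) := by
  have key : ∀ (a b : Fin n) (y : Fin n → ℝ), partialDeriv a (partialDeriv b v) y =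
      fderiv ℝ (fderiv ℝ v) y (Pi.single a 1) (Pi.single b 1) := fun a b y => by
    rw [partialDeriv_eq_fderiv (contDiff_partialDeriv hv b), partialDeriv_eq_fderiv hv]
    have h2 : DifferentiableAt ℝ (fderiv ℝ v) y :=
      ((hv.fderiv_right (m := ∞) (by simp)).differentiable (by simp)) y
    simp only
    rw [fderiv_clm_apply h2 (differentiableAt_const _)]
    simp
  funext y
  rw [key, key]
  exact (hv.contDiffAt.isSymmSndFDerivAt (by
    rw [minSmoothness_of_isRCLikeNormedField]
    exact WithTop.coe_le_coe.2 (le_top : (2 : ℕ∞) ≤ ⊤))) _ _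

theorem contDiff_iterate_partialDeriv {n : ℕ} (i : Fin n) (k : ℕ) :
    ∀ {v : (Fin n → ℝ) → ℝ}, ContDiff ℝ ∞ v → ContDiff ℝ ∞ ((partialDeriv i)^[k] v) := by
  induction k with
  | zero => exact fun h => h
  | succ k ih => exact fun h => ih (contDiff_partialDeriv h i)

theorem contDiff_foldr_partialDeriv {n : ℕ} (η : Fin n → ℕ) {v : (Fin n → ℝ) → ℝ}
    (hv : ContDiff ℝ ∞ v) (l : List (Fin n)) :
    ContDiff ℝ ∞ (l.foldr (fun i g => (partialDeriv i)^[η i] g) v) := by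
  induction l with
  | nil => exact hv
  | cons j l ih => exact contDiff_iterate_partialDeriv j _ ih

theorem iterate_partialDeriv_comm {n : ℕ} (i j : Fin n) (k : ℕ) :
    ∀ {v : (Fin n → ℝ) → ℝ}, ContDiff ℝ ∞ v →
      (partialDeriv j)^[k] (partialDeriv i v) = partialDeriv i ((partialDeriv j)^[k] v) := by
  induction k with
  | zero => exact fun _ => rfl
  | succ k ih =>
    intro v h
    rw [Function.iterate_succ_apply, Function.iterate_succ_apply, partialDeriv_comm h j i,
      ih (contDiff_partialDeriv h j)]

theorem foldr_partialDeriv_comm {n : ℕ} (η : Fin n → ℕ) (i : Fin n) {v : (Fin n → ℝ) → ℝ}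
    (hv : ContDiff ℝ ∞ v) (l : List (Fin n)) :
    l.foldr (fun j g => (partialDeriv j)^[η j] g) (partialDeriv i v) =
      partialDeriv i (l.foldr (fun j g => (partialDeriv j)^[η j] g) v) := by
  induction l with
  | nil => rfl
  | cons j l ih =>
    simp only [List.foldr_cons]
    rw [ih, iterate_partialDeriv_comm i j _ (contDiff_foldr_partialDeriv η hv l)]

/-- The case `i ∉ l` serves the induction over sublists. For the full list only the first case
occurs. -/
theorem foldr_partialDeriv_add_unit {n : ℕ} (η : Fin n → ℕ) (i : Fin n) {v : (Fin n → ℝ) → ℝ}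
    (hv : ContDiff ℝ ∞ v) (l : List (Fin n)) (hl : l.Nodup) :
    l.foldr (fun j g => (partialDeriv j)^[(η + unit i) j] g) v =
      if i ∈ l then partialDeriv i (l.foldr (fun j g => (partialDeriv j)^[η j] g) v)
      else l.foldr (fun j g => (partialDeriv j)^[η j] g) v := by
  induction l with
  | nil => simp
  | cons j l ih =>
    rw [List.nodup_cons] at hl
    simp only [List.foldr_cons]
    rw [ih hl.2]
    by_cases hij : i = j
    · subst hij
      simp only [hl.1, if_false, List.mem_cons, true_or, if_true, Pi.add_apply, unit,
        Pi.single_eq_same]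
      rw [Function.iterate_succ_apply']
    · have h0 : (η + unit i) j = η j := by simp [unit, Pi.single_eq_of_ne (Ne.symm hij)]
      rw [h0]
      by_cases hi : i ∈ l
      · simp only [hi, if_true, List.mem_cons, or_true]
        rw [iterate_partialDeriv_comm i j _ (contDiff_foldr_partialDeriv η hv l)]
      · simp [hi, hij]

/-- With the extra derivative innermost, the definition of a weak derivative can be applied to the
test function `∂ᵢv`. -/
theorem mixedDeriv_add_unit {n : ℕ} (η : Fin n → ℕ) (i : Fin n) {v : (Fin n → ℝ) → ℝ}
    (hv : ContDiff ℝ ∞ v) : mixedDeriv (η + unit i) v = mixedDeriv η (partialDeriv i v) := by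
  unfold mixedDeriv
  rw [foldr_partialDeriv_add_unit η i hv _ (List.nodup_finRange n), foldr_partialDeriv_comm η i hv]
  simp

theorem mixedDeriv_zero {n : ℕ} (f : (Fin n → ℝ) → ℝ) : mixedDeriv 0 f = f := by
  unfold mixedDeriv
  induction List.finRange n with
  | nil => rfl
  | cons j l ih => simp

theorem order_add_unit {n : ℕ} (η : Fin n → ℕ) (i : Fin n) :
    order (η + unit i) = order η + 1 := by
  simp [order, unit, Finset.sum_add_distrib, Finset.sum_pi_single']

/-! ### Weak derivatives -/

theorem hasWeakDeriv_zero {n : ℕ} {f : (Fin n → ℝ) → ℝ} (hf : Continuous f) :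
    HasWeakDeriv 0 f f :=
  ⟨hf.locallyIntegrable, fun v _ _ => by simp [mixedDeriv_zero, order]⟩

/-- A classical partial derivative of a weak derivative is a weak derivative. -/
theorem HasWeakDeriv.add_unit {n : ℕ} {η : Fin n → ℕ} {i : Fin n} {f G G' : (Fin n → ℝ) → ℝ}
    (h : HasWeakDeriv η f G) (hG : Continuous G) (hG' : Continuous G')
    (hd : ∀ y, HasLineDerivAt ℝ G (G' y) y (Pi.single i 1)) :
    HasWeakDeriv (η + unit i) f G' := by
  refine ⟨hG'.locallyIntegrable, fun v hv hc => ?_⟩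
  have hv' := contDiff_partialDeriv hv i
  have hc' := hasCompactSupport_partialDeriv hv hc i
  -- The compact support of `v` makes all products integrable and removes boundary terms.
  have hparts : ∫ y, G y * partialDeriv i v y = -∫ y, G' y * v y := by
    have := integral_bilinear_hasLineDerivAt_right_eq_neg_left_of_integrable
      (μ := (volume : Measure (Fin n → ℝ))) (B := ContinuousLinearMap.mul ℝ ℝ)
      (f := G) (f' := G') (g := v) (g' := partialDeriv i v) (v := Pi.single i 1)
      ((hG'.mul hv.continuous).integrable_of_hasCompactSupport hc.mul_left)
      ((hG.mul hv'.continuous).integrable_of_hasCompactSupport hc'.mul_left)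
      ((hG.mul hv.continuous).integrable_of_hasCompactSupport hc.mul_left)
      (fun y _ => hd y)
      (fun y _ => ((hv.differentiable (by simp)) y).lineDifferentiableAt.hasLineDerivAt)
    simpa using this
  have h2 := h.2 _ hv' hc'
  rw [hparts] at h2
  rw [mixedDeriv_add_unit η i hv, order_add_unit, pow_succ]
  linarith

theorem HasWeakDeriv.eq_of_continuous {n : ℕ} {η : Fin n → ℕ} {f G₁ G₂ : (Fin n → ℝ) → ℝ}
    (h₁ : HasWeakDeriv η f G₁) (h₂ : HasWeakDeriv η f G₂) (hc₁ : Continuous G₁)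
    (hc₂ : Continuous G₂) : G₁ = G₂ :=
  (hc₁.ae_eq_iff_eq volume hc₂).1 (h₁.ae_eq h₂)

/-! ### Families of mixed derivatives -/

theorem iterate_partialDeriv_eq {n : ℕ} {ν : Fin n → ℕ} {G : (Fin n → ℕ) → (Fin n → ℝ) → ℝ}
    (hG : ∀ (η : Fin n → ℕ) (i : Fin n), η + unit i ≤ ν →
      ∀ y, HasLineDerivAt ℝ (G η) (G (η + unit i) y) y (Pi.single i 1))
    (η : Fin n → ℕ) (i : Fin n) (k : ℕ) (hk : η + k • unit i ≤ ν) :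
    (partialDeriv i)^[k] (G η) = G (η + k • unit i) := by
  induction k with
  | zero => simp
  | succ k ih =>
    rw [succ_nsmul, ← add_assoc] at hk ⊢
    rw [Function.iterate_succ_apply', ih (le_trans (by simp) hk)]
    funext y
    exact (hG _ i hk y).lineDeriv

theorem mixedDeriv_eq_family {n : ℕ} {ν : Fin n → ℕ} {G : (Fin n → ℕ) → (Fin n → ℝ) → ℝ}
    (hG : ∀ (η : Fin n → ℕ) (i : Fin n), η + unit i ≤ ν →
      ∀ y, HasLineDerivAt ℝ (G η) (G (η + unit i) y) y (Pi.single i 1))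
    {η : Fin n → ℕ} (hη : η ≤ ν) : mixedDeriv η (G 0) = G η := by
  -- Induction over the list of variables already processed: applying their derivatives to `G 0`
  -- reaches `η` restricted to these variables.
  have key : ∀ l : List (Fin n), l.Nodup →
      l.foldr (fun i g => (partialDeriv i)^[η i] g) (G 0) = G fun i => if i ∈ l then η i else 0 := by
    intro l
    induction l with
    | nil => intro _; simp; rfl
    | cons j l ih =>
      intro hl
      rw [List.nodup_cons] at hl
      have e : (fun i => if i ∈ j :: l then η i else 0) =
          (fun i => if i ∈ l then η i else 0) + η j • unit j := by
        funext i
        by_cases hij : i = j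
        · subst hij; simp [hl.1, unit]
        · simp [hij, unit]
      rw [List.foldr_cons, ih hl.2, e]
      refine iterate_partialDeriv_eq hG _ _ _ (e ▸ fun i => ?_)
      simp only
      split_ifs
      · exact hη i
      · exact Nat.zero_le _
  rw [mixedDeriv, key _ (List.nodup_finRange n)]
  simp

/-! ### Distribution functions -/

theorem distFun_nonneg {ρ : ℝ → ℝ} (h : IsDensity ρ) (x : ℝ) : 0 ≤ distFun ρ x :=
  setIntegral_nonneg measurableSet_Iic fun z _ => h.nonneg z

theorem distFun_le_one {ρ : ℝ → ℝ} (h : IsDensity ρ) (x : ℝ) : distFun ρ x ≤ 1 := by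
  rw [← h.integral_eq_one]
  exact setIntegral_le_integral h.integrable (Eventually.of_forall h.nonneg)

theorem distFun_eq {ρ : ℝ → ℝ} (h : IsDensity ρ) (x : ℝ) :
    distFun ρ x = distFun ρ 0 + ∫ z in (0 : ℝ)..x, ρ z := by
  rw [← intervalIntegral.integral_Iic_sub_Iic h.integrable.integrableOn h.integrable.integrableOn]
  simp [distFun]

theorem continuous_distFun {ρ : ℝ → ℝ} (h : IsDensity ρ) : Continuous (distFun ρ) := by
  rw [funext (distFun_eq h)]
  exact continuous_const.add
    (intervalIntegral.continuous_primitive (fun _ _ => h.integrable.intervalIntegrable) 0)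

theorem hasDerivAt_distFun {ρ : ℝ → ℝ} (h : IsDensity ρ) (hc : Continuous ρ) (x : ℝ) :
    HasDerivAt (distFun ρ) (ρ x) x := by
  rw [funext (distFun_eq h)]
  exact (intervalIntegral.integral_hasDerivAt_right h.integrable.intervalIntegrable
    hc.stronglyMeasurable.stronglyMeasurableAtFilter hc.continuousAt).const_add _

theorem tendsto_distFun_atBot {ρ : ℝ → ℝ} (h : IsDensity ρ) :
    Tendsto (distFun ρ) atBot (𝓝 0) := by
  have h1 := intervalIntegral_tendsto_integral_Iic 0 h.integrable.integrableOn tendsto_id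
  have h2 : Tendsto (fun x => distFun ρ 0 - ∫ z in x..(0 : ℝ), ρ z) atBot (𝓝 0) := by
    simpa [distFun] using h1.const_sub (distFun ρ 0)
  refine h2.congr fun x => ?_
  rw [distFun_eq h x, intervalIntegral.integral_symm]
  ring

/-! ### Level sets of functions increasing in the first variable -/

section Level

variable {d : ℕ} {φ : (Fin (d + 1) → ℝ) → ℝ} {t : ℝ} {y : Fin d → ℝ}

theorem apply_xi (hy : y ∈ levelDomain φ t) : φ (Fin.cons (xi φ t y) y) = t :=
  Classical.epsilon_spec (p := fun y₀ : ℝ => φ (Fin.cons y₀ y) = t) hy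

theorem le_xi_iff (hm : ∀ y, StrictMono fun y₀ : ℝ => φ (Fin.cons y₀ y))
    (hy : y ∈ levelDomain φ t) {c : ℝ} : c ≤ xi φ t y ↔ φ (Fin.cons c y) ≤ t := by
  conv_rhs => rw [← apply_xi hy]
  exact ((hm y).le_iff_le (a := c) (b := xi φ t y)).symm

theorem xi_le_iff (hm : ∀ y, StrictMono fun y₀ : ℝ => φ (Fin.cons y₀ y))
    (hy : y ∈ levelDomain φ t) {c : ℝ} : xi φ t y ≤ c ↔ t ≤ φ (Fin.cons c y) := by
  conv_rhs => rw [← apply_xi hy]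
  exact ((hm y).le_iff_le (a := xi φ t y) (b := c)).symm

theorem continuous_cons (c : ℝ) : Continuous fun y : Fin d → ℝ => (Fin.cons c y : Fin (d + 1) → ℝ) :=
  continuous_const.finCons continuous_id

theorem continuous_cons_left (y : Fin d → ℝ) :
    Continuous fun c : ℝ => (Fin.cons c y : Fin (d + 1) → ℝ) :=
  Continuous.finCons (A := fun _ => ℝ) (f := fun c : ℝ => c) (g := fun _ : ℝ => y) continuous_id continuous_const

/-- Intermediate value theorem between `c` and a point where `φ(·, y)` has grown beyond `t`.
Consequently `φ(·, y)` can miss the value `t` only by staying above it. -/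
theorem mem_levelDomain_of_le (hc : Continuous φ)
    (ht : ∀ y : Fin d → ℝ, Tendsto (fun y₀ : ℝ => φ (Fin.cons y₀ y)) atTop atTop) {c : ℝ}
    (h : φ (Fin.cons c y) ≤ t) : y ∈ levelDomain φ t := by
  obtain ⟨b, hb, hcb⟩ := ((tendsto_atTop.1 (ht y) t).and (eventually_ge_atTop c)).exists
  obtain ⟨x, -, hx⟩ := intermediate_value_Icc hcb
    (hc.comp (continuous_cons_left y)).continuousOn ⟨h, hb⟩
  exact ⟨x, hx⟩

theorem lt_of_notMem_levelDomain (hc : Continuous φ)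
    (ht : ∀ y : Fin d → ℝ, Tendsto (fun y₀ : ℝ => φ (Fin.cons y₀ y)) atTop atTop)
    (hy : y ∉ levelDomain φ t) (c : ℝ) : t < φ (Fin.cons c y) := by
  by_contra h
  exact hy (mem_levelDomain_of_le hc ht (not_lt.1 h))

theorem isOpen_levelDomain (hc : Continuous φ)
    (hm : ∀ y, StrictMono fun y₀ : ℝ => φ (Fin.cons y₀ y))
    (ht : ∀ y : Fin d → ℝ, Tendsto (fun y₀ : ℝ => φ (Fin.cons y₀ y)) atTop atTop) (t : ℝ) :
    IsOpen (levelDomain φ t) := by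
  rw [isOpen_iff_mem_nhds]
  rintro y ⟨y₀, hy₀⟩
  -- Moving `y₀` down makes the inequality strict, so it persists for nearby `y`.
  have h1 : φ (Fin.cons (y₀ - 1) y) < t := by
    rw [← hy₀]
    exact hm y (by linarith)
  filter_upwards [(hc.comp (continuous_cons (y₀ - 1))).continuousAt.eventually_lt_const h1]
    with z hz
  exact mem_levelDomain_of_le hc ht (le_of_lt hz)

/-- By `xi_le_iff` and `le_xi_iff`, the conditions `c < ξ` and `ξ < c` read `φ(c, y) < t` and `t <
φ(c, y)`, which are open in `y`. -/
theorem continuousOn_xi (hc : Continuous φ)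
    (hm : ∀ y, StrictMono fun y₀ : ℝ => φ (Fin.cons y₀ y)) :
    ContinuousOn (xi φ t) (levelDomain φ t) := by
  intro y hy
  rw [ContinuousWithinAt, tendsto_order]
  constructor
  · intro c hcx
    have h1 : φ (Fin.cons c y) < t := by
      rw [← not_le, ← xi_le_iff hm hy, not_le]
      exact hcx
    filter_upwards [self_mem_nhdsWithin, nhdsWithin_le_nhds
      ((hc.comp (continuous_cons c)).continuousAt.eventually_lt_const h1)] with z hz hz'
    rw [← not_le, xi_le_iff hm hz, not_le]
    exact hz'
  · intro c hcx
    have h1 : t < φ (Fin.cons c y) := by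
      rw [← not_le, ← le_xi_iff hm hy, not_le]
      exact hcx
    filter_upwards [self_mem_nhdsWithin, nhdsWithin_le_nhds
      ((hc.comp (continuous_cons c)).continuousAt.eventually_const_lt h1)] with z hz hz'
    rw [← not_le, le_xi_iff hm hz, not_le]
    exact hz'

/-- Outside the level domain `φ(c, y) > t` for every `c`. This persists near `y` and forces `ξ ≤ c`
there. -/
theorem tendsto_xi_atBot (hc : Continuous φ)
    (hm : ∀ y, StrictMono fun y₀ : ℝ => φ (Fin.cons y₀ y))
    (ht : ∀ y : Fin d → ℝ, Tendsto (fun y₀ : ℝ => φ (Fin.cons y₀ y)) atTop atTop)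
    (hy : y ∉ levelDomain φ t) : Tendsto (xi φ t) (𝓝[levelDomain φ t] y) atBot := by
  rw [tendsto_atBot]
  intro c
  filter_upwards [self_mem_nhdsWithin, nhdsWithin_le_nhds
    ((hc.comp (continuous_cons c)).continuousAt.eventually_const_lt
      (lt_of_notMem_levelDomain hc ht hy c))] with z hz hz'
  exact (xi_le_iff hm hz).2 (le_of_lt hz')

theorem preintegrate_ind_of_mem (ρ : ℝ → ℝ)
    (hm : ∀ y, StrictMono fun y₀ : ℝ => φ (Fin.cons y₀ y)) (hy : y ∈ levelDomain φ t) :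
    preintegrate ρ (fun x => ind (t - φ x)) y = distFun ρ (xi φ t y) := by
  rw [preintegrate, distFun, ← integral_indicator measurableSet_Iic]
  congr 1
  funext c
  by_cases hcx : c ≤ xi φ t y
  · rw [Set.indicator_of_mem (by exact hcx), ind, if_pos (by linarith [(le_xi_iff hm hy).1 hcx]),
      one_mul]
  · rw [Set.indicator_of_notMem (by exact hcx), ind,
      if_neg (fun h => hcx ((le_xi_iff hm hy).2 (by linarith))), zero_mul]

theorem preintegrate_ind_of_notMem (ρ : ℝ → ℝ) (hc : Continuous φ)
    (ht : ∀ y : Fin d → ℝ, Tendsto (fun y₀ : ℝ => φ (Fin.cons y₀ y)) atTop atTop)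
    (hy : y ∉ levelDomain φ t) : preintegrate ρ (fun x => ind (t - φ x)) y = 0 := by
  rw [preintegrate]
  refine integral_eq_zero_of_ae (Eventually.of_forall fun c => ?_)
  have := lt_of_notMem_levelDomain hc ht hy c
  simp [ind, this]

theorem continuous_preintegrate_ind {ρ : ℝ → ℝ} (hρ : IsDensity ρ) (hc : Continuous φ)
    (hm : ∀ y, StrictMono fun y₀ : ℝ => φ (Fin.cons y₀ y))
    (ht : ∀ y : Fin d → ℝ, Tendsto (fun y₀ : ℝ => φ (Fin.cons y₀ y)) atTop atTop) :
    Continuous (preintegrate ρ (fun x => ind (t - φ x))) := by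
  have hU := isOpen_levelDomain hc hm ht t
  refine continuous_of_extend_zero hU ?_ (fun y hy => preintegrate_ind_of_notMem ρ hc ht hy) ?_
  · exact ((continuous_distFun hρ).comp_continuousOn (continuousOn_xi hc hm)).congr
      fun y hy => preintegrate_ind_of_mem ρ hm hy
  · intro z hz
    have hzU : z ∉ levelDomain φ t := by rw [frontier, hU.interior_eq] at hz; exact hz.2
    refine ((tendsto_distFun_atBot hρ).comp (tendsto_xi_atBot hc hm ht hzU)).congr' ?_
    filter_upwards [self_mem_nhdsWithin] with y hy using (preintegrate_ind_of_mem ρ hm hy).symm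

theorem abs_preintegrate_ind_le_one {ρ : ℝ → ℝ} (hρ : IsDensity ρ) (hc : Continuous φ)
    (hm : ∀ y, StrictMono fun y₀ : ℝ => φ (Fin.cons y₀ y))
    (ht : ∀ y : Fin d → ℝ, Tendsto (fun y₀ : ℝ => φ (Fin.cons y₀ y)) atTop atTop)
    (y : Fin d → ℝ) : |preintegrate ρ (fun x => ind (t - φ x)) y| ≤ 1 := by
  by_cases hy : y ∈ levelDomain φ t
  · rw [preintegrate_ind_of_mem ρ hm hy, abs_of_nonneg (distFun_nonneg hρ _)]
    exact distFun_le_one hρ _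
  · rw [preintegrate_ind_of_notMem ρ hc ht hy]
    simp

/-! ### Differentiation along the level set -/

theorem cons_add_smul_single (i : Fin d) (u s : ℝ) (y : Fin d → ℝ) :
    (Fin.cons u (y + s • Pi.single i 1) : Fin (d + 1) → ℝ) =
      Fin.cons u y + s • Pi.single i.succ 1 := by
  funext j
  refine Fin.cases ?_ (fun j => ?_) j
  · simp
  · by_cases h : j = i
    · subst h; simp
    · simp [h]

theorem cons_eq_add_smul_single (u : ℝ) (y : Fin d → ℝ) :
    (Fin.cons u y : Fin (d + 1) → ℝ) = Fin.cons 0 y + u • Pi.single 0 1 := by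
  funext j
  refine Fin.cases ?_ (fun j => ?_) j <;> simp

/-- Differentiability is claimed only in the plane of the variables `y₀` and `yᵢ`: continuous
partial derivatives in these two directions suffice, and nothing is needed in the others. -/
theorem hasStrictFDerivAt_cons {F F₀ F₁ : (Fin (d + 1) → ℝ) → ℝ} {i : Fin d}
    (h₀ : Continuous F₀) (h₁ : Continuous F₁)
    (hd₀ : ∀ x, HasLineDerivAt ℝ F (F₀ x) x (Pi.single 0 1))
    (hd₁ : ∀ x, HasLineDerivAt ℝ F (F₁ x) x (Pi.single i.succ 1)) (y : Fin d → ℝ) (u : ℝ) :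
    HasStrictFDerivAt (fun p : ℝ × ℝ => F (Fin.cons p.1 (y + p.2 • Pi.single i 1)))
      ((ContinuousLinearMap.toSpanSingleton ℝ (F₀ (Fin.cons u y))).coprod
        (ContinuousLinearMap.toSpanSingleton ℝ (F₁ (Fin.cons u y)))) (u, 0) := by
  have hc : Continuous fun p : ℝ × ℝ =>
      (Fin.cons p.1 (y + p.2 • Pi.single i 1) : Fin (d + 1) → ℝ) :=
    Continuous.finCons (A := fun _ => ℝ) (f := fun p : ℝ × ℝ => p.1)
      (g := fun p : ℝ × ℝ => y + p.2 • Pi.single i 1) continuous_fst (by fun_prop)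
  have hspan : Continuous fun c : ℝ => ContinuousLinearMap.toSpanSingleton ℝ c :=
    (ContinuousLinearMap.toSpanSingletonCLE (𝕜 := ℝ) (E := ℝ)).continuous
  have hc₀ : Continuous fun p : ℝ × ℝ => ContinuousLinearMap.toSpanSingleton ℝ
      (F₀ (Fin.cons p.1 (y + p.2 • Pi.single i 1))) := hspan.comp (h₀.comp hc)
  have hc₁ : Continuous fun p : ℝ × ℝ => ContinuousLinearMap.toSpanSingleton ℝ
      (F₁ (Fin.cons p.1 (y + p.2 • Pi.single i 1))) := hspan.comp (h₁.comp hc)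
  have hp₀ : ∀ v : ℝ × ℝ, HasFDerivAt (fun a => F (Fin.cons a (y + v.2 • Pi.single i 1)))
      (ContinuousLinearMap.toSpanSingleton ℝ (F₀ (Fin.cons v.1 (y + v.2 • Pi.single i 1)))) v.1 :=
    fun v => by
      have h := hasDerivAt_line_of_hasLineDerivAt (s := v.1)
        (y := Fin.cons 0 (y + v.2 • Pi.single i 1)) (hd₀ _)
      simp only [← cons_eq_add_smul_single] at h
      exact h.hasFDerivAt
  have hp₁ : ∀ v : ℝ × ℝ, HasFDerivAt (fun s => F (Fin.cons v.1 (y + s • Pi.single i 1)))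
      (ContinuousLinearMap.toSpanSingleton ℝ (F₁ (Fin.cons v.1 (y + v.2 • Pi.single i 1)))) v.2 :=
    fun v => by
      have h := hasDerivAt_line_of_hasLineDerivAt (s := v.2) (y := Fin.cons v.1 y) (hd₁ _)
      simp only [← cons_add_smul_single] at h
      exact h.hasFDerivAt
  have e : y + (0 : ℝ) • Pi.single i (1 : ℝ) = y := by rw [zero_smul, add_zero]
  rw [show F₀ (Fin.cons u y) = F₀ (Fin.cons u (y + (0 : ℝ) • Pi.single i (1 : ℝ))) by rw [e],
    show F₁ (Fin.cons u y) = F₁ (Fin.cons u (y + (0 : ℝ) • Pi.single i (1 : ℝ))) by rw [e]]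
  obtain ⟨f₀, hf₀⟩ : ∃ f, f = (fun a s : ℝ => ContinuousLinearMap.toSpanSingleton ℝ
      (F₀ (Fin.cons a (y + s • Pi.single i 1)))) := ⟨_, rfl⟩
  obtain ⟨f₁, hf₁⟩ : ∃ f, f = (fun a s : ℝ => ContinuousLinearMap.toSpanSingleton ℝ
      (F₁ (Fin.cons a (y + s • Pi.single i 1)))) := ⟨_, rfl⟩
  have := hasStrictFDerivAt_uncurry_coprod (𝕜 := ℝ) (u := ((u, 0) : ℝ × ℝ))
    (f := fun a s => F (Fin.cons a (y + s • Pi.single i 1))) (f₁ := f₀) (f₂ := f₁)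
    (Eventually.of_forall fun v => by subst hf₀; exact hp₀ v)
    (Eventually.of_forall fun v => by subst hf₁; exact hp₁ v)
    (by subst hf₀; exact hc₀.continuousAt) (by subst hf₁; exact hc₁.continuousAt)
  subst hf₀ hf₁
  exact this

/-- Implicit differentiation. -/
theorem hasDerivAt_of_implicit {f : ℝ × ℝ → ℝ} {a b u : ℝ} {x : ℝ → ℝ} (ha : 0 < a)
    (hf : HasFDerivAt f ((ContinuousLinearMap.toSpanSingleton ℝ a).coprod
      (ContinuousLinearMap.toSpanSingleton ℝ b)) (u, 0))
    (hx0 : x 0 = u) (hx : ContinuousAt x 0) (hconst : ∀ᶠ s in 𝓝 0, f (x s, s) = f (u, 0)) :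
    HasDerivAt x (-(b / a)) 0 := by
  have ht : Tendsto (fun s => (x s, s)) (𝓝 0) (𝓝 (u, (0 : ℝ))) := by
    rw [← hx0]
    exact hx.prodMk_nhds continuousAt_id
  have h1 := (hasFDerivAt_iff_isLittleO.1 hf).comp_tendsto ht
  have h2 : (fun s => a * (x s - u) + b * s) =o[𝓝 0] fun s => ((x s - u, s) : ℝ × ℝ) := by
    have h3 := h1.neg_left
    refine (h3.congr' ?_ ?_)
    · filter_upwards [hconst] with s hs
      simp [hs]
      ring
    · exact Eventually.of_forall fun s => by simp
  -- With `X = x s - u`, the estimate `a|X| ≤ (a/2)(|X| + |s|) + |b||s|` allows half of `a|X|` to be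
  -- absorbed, leaving `|X| ≤ ((a + 2|b|)/a)|s|`.
  have hO : (fun s => x s - u) =O[𝓝 0] fun s : ℝ => s := by
    have h4 := Asymptotics.isLittleO_iff.1 h2 (half_pos ha)
    refine Asymptotics.IsBigO.of_bound ((a + 2 * |b|) / a) ?_
    filter_upwards [h4] with s hs
    have h5 : ‖((x s - u, s) : ℝ × ℝ)‖ ≤ |x s - u| + |s| := by
      rw [Prod.norm_def]
      exact max_le (le_add_of_nonneg_right (abs_nonneg _)) (le_add_of_nonneg_left (abs_nonneg _))
    have h6 : a * |x s - u| ≤ |a * (x s - u) + b * s| + |b| * |s| := by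
      have := abs_sub (a * (x s - u) + b * s) (b * s)
      rw [add_sub_cancel_right, abs_mul, abs_of_pos ha, abs_mul b] at this
      exact this
    rw [Real.norm_eq_abs] at hs ⊢
    rw [Real.norm_eq_abs, div_mul_eq_mul_div, le_div_iff₀ ha]
    nlinarith [mul_le_mul_of_nonneg_left h5 (half_pos ha).le]
  have h7 : (fun s => a * (x s - u) + b * s) =o[𝓝 0] fun s : ℝ => s :=
    h2.trans_isBigO (hO.prod_left (Asymptotics.isBigO_refl _ _))
  rw [hasDerivAt_iff_isLittleO]
  refine (h7.const_mul_left a⁻¹).congr (fun s => ?_) fun s => (sub_zero s).symm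
  rw [hx0, sub_zero, smul_eq_mul]
  field_simp
  ring

end Level

/-! ### Consequences of smoothness and monotonicity -/

section Smooth

variable {d : ℕ} {W : Weights (d + 1)} {ν : Fin d → ℕ} {φ : (Fin (d + 1) → ℝ) → ℝ}

theorem le_cons_iff {α : Fin (d + 1) → ℕ} {k : ℕ} :
    α ≤ (Fin.cons k ν : Fin (d + 1) → ℕ) ↔ α 0 ≤ k ∧ ∀ i, α i.succ ≤ ν i := by
  rw [Pi.le_def, Fin.forall_fin_succ]
  simp

theorem SmoothMonotone.continuous_mixedDeriv (hφ : SmoothMonotone W ν φ) {α : Fin (d + 1) → ℕ}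
    (h0 : α 0 ≤ order ν + 1) (hs : ∀ i : Fin d, α i.succ ≤ ν i) : Continuous (mixedDeriv α φ) :=
  hφ.mem.2.1 α (le_cons_iff.2 ⟨h0, hs⟩)

theorem SmoothMonotone.hasLineDerivAt (hφ : SmoothMonotone W ν φ) {α : Fin (d + 1) → ℕ}
    {i : Fin (d + 1)} (h0 : (α + unit i) 0 ≤ order ν + 1)
    (hs : ∀ j : Fin d, (α + unit i) j.succ ≤ ν j) (x : Fin (d + 1) → ℝ) :
    HasLineDerivAt ℝ (mixedDeriv α φ) (mixedDeriv (α + unit i) φ x) x (Pi.single i 1) :=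
  hφ.mem.2.2 α i (le_cons_iff.2 ⟨h0, hs⟩) x

theorem SmoothMonotone.continuous (hφ : SmoothMonotone W ν φ) : Continuous φ := by
  have := hφ.continuous_mixedDeriv (α := 0) (by simp) (by simp)
  rwa [mixedDeriv_zero] at this

theorem SmoothMonotone.hasLineDerivAt_zero (hφ : SmoothMonotone W ν φ) (x : Fin (d + 1) → ℝ) :
    HasLineDerivAt ℝ φ (mixedDeriv (unit 0) φ x) x (Pi.single 0 1) := by
  have := hφ.hasLineDerivAt (α := 0) (i := 0) (by simp [unit]) (by simp [unit]) x
  rwa [mixedDeriv_zero, zero_add] at this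

theorem SmoothMonotone.partialDeriv_zero (hφ : SmoothMonotone W ν φ) :
    partialDeriv 0 φ = mixedDeriv (unit 0) φ :=
  funext fun x => (hφ.hasLineDerivAt_zero x).lineDeriv

theorem SmoothMonotone.strictMono (hφ : SmoothMonotone W ν φ) (y : Fin d → ℝ) :
    StrictMono fun y₀ : ℝ => φ (Fin.cons y₀ y) := by
  refine strictMono_of_deriv_pos fun u => ?_
  have h := hasDerivAt_line_of_hasLineDerivAt (s := u) (y := Fin.cons 0 y)
    (hφ.hasLineDerivAt_zero _)
  simp only [← cons_eq_add_smul_single] at h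
  rw [h.deriv, ← hφ.partialDeriv_zero]
  exact hφ.deriv_pos _

theorem SmoothMonotone.isOpen_levelDomain (hφ : SmoothMonotone W ν φ) (t : ℝ) :
    IsOpen (levelDomain φ t) :=
  Preint.isOpen_levelDomain hφ.continuous hφ.strictMono hφ.tendsto_atTop t

theorem SmoothMonotone.continuousOn_xi (hφ : SmoothMonotone W ν φ) (t : ℝ) :
    ContinuousOn (xi φ t) (levelDomain φ t) :=
  Preint.continuousOn_xi hφ.continuous hφ.strictMono

theorem line_eventually_mem {U : Set (Fin d → ℝ)} (hU : IsOpen U) {y : Fin d → ℝ} (hy : y ∈ U)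
    (e : Fin d → ℝ) : ∀ᶠ s : ℝ in 𝓝 0, y + s • e ∈ U :=
  (Continuous.tendsto' (by fun_prop) 0 _ (by simp)).eventually (hU.mem_nhds hy)

theorem unit_zero_succ (j : Fin d) : (unit (0 : Fin (d + 1))) j.succ = 0 := by simp [unit]

theorem unit_succ_zero (i : Fin d) : (unit i.succ) 0 = 0 := by
  simp [unit]

theorem unit_succ_succ (i j : Fin d) : (unit i.succ) j.succ = unit i j := by
  by_cases h : j = i
  · subst h; simp [unit]
  · simp [unit, h]

/-- Chain rule along `s ↦ (x(s), y + s eᵢ)`. It costs one more derivative in `y₀`, which is why `φ`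
is assumed to have `|ν| + 1` of them. -/
theorem SmoothMonotone.hasDerivAt_mixedDeriv_curve (hφ : SmoothMonotone W ν φ)
    {α : Fin (d + 1) → ℕ} {i : Fin d} (h0 : α 0 ≤ order ν)
    (hs : ∀ j : Fin d, α j.succ + unit i j ≤ ν j) {y : Fin d → ℝ} {x : ℝ → ℝ} {x' : ℝ}
    (hx : HasDerivAt x x' 0) :
    HasDerivAt (fun s => mixedDeriv α φ (Fin.cons (x s) (y + s • Pi.single i 1)))
      (mixedDeriv (α + unit 0) φ (Fin.cons (x 0) y) * x' +
        mixedDeriv (α + unit i.succ) φ (Fin.cons (x 0) y)) 0 := by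
  have a0 : (α + unit (0 : Fin (d + 1))) 0 ≤ order ν + 1 := by simpa [unit] using h0
  have a1 : ∀ j : Fin d, (α + unit (0 : Fin (d + 1))) j.succ ≤ ν j := fun j => by
    rw [Pi.add_apply, unit_zero_succ]
    exact le_trans (Nat.le_add_right _ _) (hs j)
  have b0 : (α + unit i.succ) 0 ≤ order ν + 1 := by
    rw [Pi.add_apply, unit_succ_zero]
    omega
  have b1 : ∀ j : Fin d, (α + unit i.succ) j.succ ≤ ν j := fun j => by
    rw [Pi.add_apply, unit_succ_succ]
    exact hs j
  have hF := (hasStrictFDerivAt_cons (hφ.continuous_mixedDeriv a0 a1)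
    (hφ.continuous_mixedDeriv b0 b1) (hφ.hasLineDerivAt a0 a1) (hφ.hasLineDerivAt b0 b1) y
    (x 0)).hasFDerivAt
  have := hF.comp_hasDerivAt (0 : ℝ) (f := fun s : ℝ => (x s, s)) (hx.prodMk (hasDerivAt_id 0))
  refine this.congr_deriv ?_
  simp [mul_comm]

theorem SmoothMonotone.hasDerivAt_xi (hφ : SmoothMonotone W ν φ) {i : Fin d} (hi : unit i ≤ ν)
    {t : ℝ} {y : Fin d → ℝ} (hy : y ∈ levelDomain φ t) :
    HasDerivAt (fun s : ℝ => xi φ t (y + s • Pi.single i 1))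
      (-(mixedDeriv (unit i.succ) φ (Fin.cons (xi φ t y) y) /
        mixedDeriv (unit 0) φ (Fin.cons (xi φ t y) y))) 0 := by
  have a0 : (0 + unit (0 : Fin (d + 1))) 0 ≤ order ν + 1 := by simp [unit]
  have a1 : ∀ j : Fin d, (0 + unit (0 : Fin (d + 1))) j.succ ≤ ν j := fun j => by simp [unit]
  have b0 : (0 + unit i.succ) 0 ≤ order ν + 1 := by rw [zero_add, unit_succ_zero]; omega
  have b1 : ∀ j : Fin d, (0 + unit i.succ) j.succ ≤ ν j := fun j => by
    rw [zero_add, unit_succ_succ]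
    exact hi j
  have hF := (hasStrictFDerivAt_cons (hφ.continuous_mixedDeriv a0 a1)
    (hφ.continuous_mixedDeriv b0 b1) (hφ.hasLineDerivAt a0 a1) (hφ.hasLineDerivAt b0 b1) y
    (xi φ t y)).hasFDerivAt
  simp only [zero_add, mixedDeriv_zero] at hF
  have hU := hφ.isOpen_levelDomain t
  refine hasDerivAt_of_implicit (by rw [← hφ.partialDeriv_zero]; exact hφ.deriv_pos _) hF
    (by simp) ?_ ?_
  · have hc := (hφ.continuousOn_xi t).continuousAt (hU.mem_nhds hy)
    have hl : ContinuousAt (fun s : ℝ => y + s • Pi.single i (1 : ℝ)) 0 := by fun_prop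
    exact ContinuousAt.comp (g := xi φ t) (by simpa using hc) hl
  · filter_upwards [line_eventually_mem hU hy (Pi.single i 1)] with s hs
    simp [apply_xi hs, apply_xi hy]

theorem continuousOn_cons_xi (hφ : SmoothMonotone W ν φ) (t : ℝ) :
    ContinuousOn (fun y => (Fin.cons (xi φ t y) y : Fin (d + 1) → ℝ)) (levelDomain φ t) := by
  have := hφ.continuousOn_xi t
  rw [continuousOn_iff_continuous_domRestrict] at this ⊢
  exact Continuous.finCons (A := fun _ => ℝ) this continuous_subtype_val

/-! ### The functions `h` -/

theorem Admissible.one_le {η : Fin d → ℕ} {r : ℕ} {α : Fin r → Fin (d + 1) → ℕ} {β : ℕ}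
    (h : Admissible 0 η r α β) : 1 ≤ r := by
  have := h.sum_zero
  omega

theorem Admissible.succ_le {q : ℕ} {η : Fin d → ℕ} {r : ℕ} {α : Fin r → Fin (d + 1) → ℕ} {β : ℕ}
    (h : Admissible q η r α β) (l : Fin r) (i : Fin d) : α l i.succ ≤ η i := by
  rw [← h.sum_succ i]
  exact Finset.single_le_sum (f := fun l => α l i.succ) (fun _ _ => Nat.zero_le _)
    (Finset.mem_univ l)

theorem order_mono {n : ℕ} {η ν : Fin n → ℕ} (h : η ≤ ν) : order η ≤ order ν :=
  Finset.sum_le_sum fun i _ => h i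

theorem sum_update_add {r n : ℕ} (α : Fin r → Fin n → ℕ) (l : Fin r) (u : Fin n → ℕ)
    (j : Fin n) : ∑ m, (Function.update α l (α l + u)) m j = ∑ m, α m j + u j := by
  have : ∀ m, (Function.update α l (α l + u)) m j = α m j + if m = l then u j else 0 := by
    intro m
    by_cases h : m = l
    · subst h; simp
    · simp [h]
  simp [this, Finset.sum_add_distrib]

/-- The derivative falls on `ρ₀^{(β)}(ξ)`: the inner factor `-Dⁱφ/D⁰φ` contributes the new index, a
sign and a power of the denominator. -/
theorem admissible_cons_unit {η : Fin d → ℕ} {r : ℕ} {α : Fin r → Fin (d + 1) → ℕ} {β : ℕ}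
    (h : Admissible 0 η r α β) (i : Fin d) :
    Admissible 0 (η + unit i) (r + 1) (Fin.cons (unit i.succ) α : Fin (r + 1) → _) (β + 1) where
  ne_zero := by
    refine Fin.cases ?_ fun l => by simpa using h.ne_zero l
    intro h0
    simpa [unit] using congrFun h0 i.succ
  ne_unit := by
    refine Fin.cases ?_ fun l => by simpa using h.ne_unit l
    intro h0
    simpa [unit] using congrFun h0 i.succ
  r_le := by have := h.r_le; rw [order_add_unit]; omega
  α_zero_le := by
    rw [order_add_unit]
    refine Fin.cases ?_ fun l => ?_
    · simp [unit_succ_zero]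
    · have := h.α_zero_le l
      simp only [Fin.cons_succ]; omega
  β_le := by have := h.β_le; rw [order_add_unit]; omega
  sum_zero := by
    have := h.sum_zero
    simp only [Fin.sum_univ_succ, Fin.cons_zero, Fin.cons_succ, unit_succ_zero]; omega
  sum_succ j := by
    have := h.sum_succ j
    simp only [Fin.sum_univ_succ, Fin.cons_zero, Fin.cons_succ, unit_succ_succ, Pi.add_apply]
    omega

theorem add_unit_ne_zero {n : ℕ} (α : Fin n → ℕ) (i : Fin n) : α + unit i ≠ 0 := fun h => by
  simpa [unit] using congrFun h i

theorem add_unit_succ_ne_unit (α : Fin (d + 1) → ℕ) (i : Fin d) : α + unit i.succ ≠ unit 0 :=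
  fun h => by simpa [unit] using congrFun h i.succ

theorem add_unit_zero_ne_unit {α : Fin (d + 1) → ℕ} (h : α ≠ 0) : α + unit 0 ≠ unit 0 :=
  fun h' => h (by simpa using h')

theorem unit_ne_zero {n : ℕ} (i : Fin n) : unit i ≠ 0 := by simpa using add_unit_ne_zero 0 i

theorem unit_succ_ne_unit (i : Fin d) : unit i.succ ≠ unit 0 := by
  simpa using add_unit_succ_ne_unit 0 i

/-- The derivative falls on `D^{α_l}φ` through its explicit dependence on `yᵢ`. -/
theorem admissible_update_succ {η : Fin d → ℕ} {r : ℕ} {α : Fin r → Fin (d + 1) → ℕ} {β : ℕ}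
    (h : Admissible 0 η r α β) (i : Fin d) (l : Fin r) :
    Admissible 0 (η + unit i) r (Function.update α l (α l + unit i.succ)) β where
  ne_zero m := by
    by_cases hm : m = l
    · subst hm; simpa using add_unit_ne_zero _ _
    · simpa [hm] using h.ne_zero m
  ne_unit m := by
    by_cases hm : m = l
    · subst hm; simpa using add_unit_succ_ne_unit _ _
    · simpa [hm] using h.ne_unit m
  r_le := by have := h.r_le; rw [order_add_unit]; omega
  α_zero_le m := by
    have := h.α_zero_le m
    rw [order_add_unit]
    by_cases hm : m = l
    · subst hm; simp only [Function.update_self, Pi.add_apply, unit_succ_zero]; omega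
    · simp only [Function.update_of_ne hm]; omega
  β_le := by have := h.β_le; rw [order_add_unit]; omega
  sum_zero := by rw [sum_update_add, unit_succ_zero]; exact h.sum_zero
  sum_succ j := by rw [sum_update_add, unit_succ_succ, h.sum_succ j]; rfl

/-- The derivative falls on `D^{α_l}φ` through `ξ`, which raises `α_l` by `e₀` and brings the factor
`-Dⁱφ/D⁰φ`. -/
theorem admissible_cons_update_zero {η : Fin d → ℕ} {r : ℕ} {α : Fin r → Fin (d + 1) → ℕ} {β : ℕ}
    (h : Admissible 0 η r α β) (i : Fin d) (l : Fin r) :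
    Admissible 0 (η + unit i) (r + 1)
      (Fin.cons (unit i.succ) (Function.update α l (α l + unit 0)) : Fin (r + 1) → _) β where
  ne_zero := by
    refine Fin.cases (unit_ne_zero _) fun m => ?_
    rw [Fin.cons_succ]
    by_cases hm : m = l
    · subst hm; simpa using add_unit_ne_zero _ _
    · simpa [hm] using h.ne_zero m
  ne_unit := by
    refine Fin.cases (unit_succ_ne_unit _) fun m => ?_
    rw [Fin.cons_succ]
    by_cases hm : m = l
    · subst hm; simpa using h.ne_zero _
    · simpa [hm] using h.ne_unit m
  r_le := by have := h.r_le; rw [order_add_unit]; omega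
  α_zero_le := by
    rw [order_add_unit]
    refine Fin.cases ?_ fun m => ?_
    · simp [unit_succ_zero]
    · have := h.α_zero_le m
      rw [Fin.cons_succ]
      by_cases hm : m = l
      · subst hm
        simp only [Function.update_self, Pi.add_apply, unit, Pi.single_eq_same]; omega
      · simp only [Function.update_of_ne hm]; omega
  β_le := by have := h.β_le; rw [order_add_unit]; omega
  sum_zero := by
    have := h.sum_zero
    simp only [Fin.sum_univ_succ, Fin.cons_zero, Fin.cons_succ, unit_succ_zero, sum_update_add]
    simp only [unit, Pi.single_eq_same]
    omega
  sum_succ j := by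
    have := h.sum_succ j
    simp only [Fin.sum_univ_succ, Fin.cons_zero, Fin.cons_succ, unit_succ_succ, sum_update_add,
      unit_zero_succ, Pi.add_apply]
    omega

/-- The derivative falls on one factor `D⁰φ` of the denominator through its explicit dependence on
`yᵢ`. -/
theorem admissible_cons_unit_add {η : Fin d → ℕ} {r : ℕ} {α : Fin r → Fin (d + 1) → ℕ} {β : ℕ}
    (h : Admissible 0 η r α β) (i : Fin d) :
    Admissible 0 (η + unit i) (r + 1) (Fin.cons (unit 0 + unit i.succ) α : Fin (r + 1) → _) β where
  ne_zero := by
    refine Fin.cases (add_unit_ne_zero _ _) fun m => ?_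
    simpa using h.ne_zero m
  ne_unit := by
    refine Fin.cases (add_unit_succ_ne_unit _ _) fun m => ?_
    simpa using h.ne_unit m
  r_le := by have := h.r_le; rw [order_add_unit]; omega
  α_zero_le := by
    rw [order_add_unit]
    refine Fin.cases ?_ fun m => ?_
    · rw [Fin.cons_zero, Pi.add_apply, unit_succ_zero, unit, Pi.single_eq_same]
      omega
    · have := h.α_zero_le m
      rw [Fin.cons_succ]; omega
  β_le := by have := h.β_le; rw [order_add_unit]; omega
  sum_zero := by
    have := h.sum_zero
    simp only [Fin.sum_univ_succ, Fin.cons_zero, Fin.cons_succ, Pi.add_apply, unit_succ_zero]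
    simp only [unit, Pi.single_eq_same]
    omega
  sum_succ j := by
    have := h.sum_succ j
    simp only [Fin.sum_univ_succ, Fin.cons_zero, Fin.cons_succ, unit_succ_succ,
      unit_zero_succ, Pi.add_apply]
    omega

/-- The derivative falls on one factor `D⁰φ` of the denominator through `ξ`. Two indices and two
signs appear, so `r` grows by two, the most that the bound `r ≤ 2|η| - 1` permits. -/
theorem admissible_cons_cons {η : Fin d → ℕ} {r : ℕ} {α : Fin r → Fin (d + 1) → ℕ} {β : ℕ}
    (h : Admissible 0 η r α β) (i : Fin d) :
    Admissible 0 (η + unit i) (r + 2)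
      (Fin.cons (unit 0 + unit 0) (Fin.cons (unit i.succ) α : Fin (r + 1) → _) : Fin (r + 2) → _)
      β where
  ne_zero := by
    refine Fin.cases (add_unit_ne_zero _ _) (Fin.cases (unit_ne_zero _) fun m => ?_)
    simpa using h.ne_zero m
  ne_unit := by
    refine Fin.cases (add_unit_zero_ne_unit (unit_ne_zero _))
      (Fin.cases (unit_succ_ne_unit _) fun m => ?_)
    simpa using h.ne_unit m
  r_le := by have := h.r_le; rw [order_add_unit]; omega
  α_zero_le := by
    -- The new index `2e₀` requires `2 ≤ |η| + 1`; `1 ≤ r ≤ 2|η| - 1` gives `|η| ≥ 1`.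
    have hr := h.r_le
    have hr' := h.one_le
    rw [order_add_unit]
    refine Fin.cases ?_ (Fin.cases ?_ fun m => ?_)
    · rw [Fin.cons_zero, Pi.add_apply, unit, Pi.single_eq_same]
      omega
    · rw [Fin.cons_succ, Fin.cons_zero, unit_succ_zero]
      omega
    · have := h.α_zero_le m
      rw [Fin.cons_succ, Fin.cons_succ]; omega
  β_le := by have := h.β_le; rw [order_add_unit]; omega
  sum_zero := by
    have := h.sum_zero
    simp only [Fin.sum_univ_succ, Fin.cons_zero, Fin.cons_succ, Pi.add_apply, unit_succ_zero]
    simp only [unit, Pi.single_eq_same]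
    omega
  sum_succ j := by
    have := h.sum_succ j
    simp only [Fin.sum_univ_succ, Fin.cons_zero, Fin.cons_succ, unit_succ_succ,
      unit_zero_succ, Pi.add_apply]
    omega

theorem SmoothMonotone.continuousOn_hFun (hφ : SmoothMonotone W ν φ) {η : Fin d → ℕ}
    (hη : η ≤ ν) {r : ℕ} {α : Fin r → Fin (d + 1) → ℕ} {β : ℕ} (h : Admissible 0 η r α β)
    (t : ℝ) : ContinuousOn (hFun φ (W.ρ 0) 0 r α β t) (levelDomain φ t) := by
  have ho := order_mono hη
  have hc := continuousOn_cons_xi hφ t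
  unfold hFun
  refine ContinuousOn.div (ContinuousOn.mul (continuousOn_const.mul ?_) ?_) ?_ ?_
  · refine (hφ.contDiff.continuous_iteratedDeriv β ?_).comp_continuousOn (hφ.continuousOn_xi t)
    have := h.β_le
    exact_mod_cast (by omega : β ≤ order ν)
  · refine continuousOn_finsetProd _ fun l _ => ?_
    refine (hφ.continuous_mixedDeriv ?_ fun i => ?_).comp_continuousOn hc
    · have := h.α_zero_le l
      omega
    · exact (h.succ_le l i).trans (hη i)
  · rw [hφ.partialDeriv_zero]
    exact ((hφ.continuous_mixedDeriv (by simp [unit])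
      (by simp [unit])).comp_continuousOn hc).pow _
  · exact fun y _ => pow_ne_zero _ (hφ.deriv_pos _).ne'

/-- The derivative of `h` in the direction of the variable `yᵢ`, as a sum of functions of the same
kind. -/
def hFunDeriv (φ : (Fin (d + 1) → ℝ) → ℝ) (ρ₀ : ℝ → ℝ) (r : ℕ) (α : Fin r → Fin (d + 1) → ℕ)
    (β : ℕ) (t : ℝ) (i : Fin d) (y : Fin d → ℝ) : ℝ :=
  hFun φ ρ₀ 0 (r + 1) (Fin.cons (unit i.succ) α : Fin (r + 1) → _) (β + 1) t y +
    ∑ l, ((hFun φ ρ₀ 0 r (Function.update α l (α l + unit i.succ)) β t y +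
      hFun φ ρ₀ 0 (r + 1)
        (Fin.cons (unit i.succ) (Function.update α l (α l + unit 0)) : Fin (r + 1) → _) β t y) +
      (hFun φ ρ₀ 0 (r + 1) (Fin.cons (unit 0 + unit i.succ) α : Fin (r + 1) → _) β t y +
      hFun φ ρ₀ 0 (r + 2)
        (Fin.cons (unit 0 + unit 0) (Fin.cons (unit i.succ) α : Fin (r + 1) → _) :
          Fin (r + 2) → _) β t y))

theorem prod_mixedDeriv_update {r : ℕ} (α : Fin r → Fin (d + 1) → ℕ) (l : Fin r)
    (v : Fin (d + 1) → ℕ) (x : Fin (d + 1) → ℝ) :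
    ∏ m, mixedDeriv (Function.update α l v m) φ x =
      mixedDeriv v φ x * ∏ m ∈ Finset.univ.erase l, mixedDeriv (α m) φ x := by
  rw [← Finset.mul_prod_erase _ _ (Finset.mem_univ l), Function.update_self]
  congr 1
  exact Finset.prod_congr rfl fun m hm => by rw [Function.update_of_ne (Finset.ne_of_mem_erase hm)]

/-- Quotient, product and chain rules along the level set. All signs are absorbed in `(-1)^r`, and
the factor `r` from differentiating `[D⁰φ]^r` becomes `r` equal summands, so no coefficients remain.
-/
theorem SmoothMonotone.hasLineDerivAt_hFun (hφ : SmoothMonotone W ν φ) {η : Fin d → ℕ} {i : Fin d}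
    (hη : η + unit i ≤ ν) {r : ℕ} {α : Fin r → Fin (d + 1) → ℕ} {β : ℕ}
    (h : Admissible 0 η r α β) {t : ℝ} {y : Fin d → ℝ} (hy : y ∈ levelDomain φ t) :
    HasLineDerivAt ℝ (hFun φ (W.ρ 0) 0 r α β t) (hFunDeriv φ (W.ρ 0) r α β t i y) y
      (Pi.single i 1) := by
  have ho := order_mono hη
  rw [order_add_unit] at ho
  have hi : unit i ≤ ν := le_trans (by simp) hη
  have hp := hφ.deriv_pos (Fin.cons (xi φ t y) y)
  have hx := hφ.hasDerivAt_xi hi hy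
  have hx0 : xi φ t (y + (0 : ℝ) • Pi.single i 1) = xi φ t y := by simp
  have hR : HasDerivAt (fun s : ℝ => iteratedDeriv β (W.ρ 0) (xi φ t (y + s • Pi.single i 1)))
      (iteratedDeriv (β + 1) (W.ρ 0) (xi φ t y) *
        -(mixedDeriv (unit i.succ) φ (Fin.cons (xi φ t y) y) /
        mixedDeriv (unit 0) φ (Fin.cons (xi φ t y) y))) 0 := by
    have hβ := h.β_le
    have hdiff := hφ.contDiff.differentiable_iteratedDeriv β
      (by exact_mod_cast (by omega : β < order ν))
    have h1 := (hdiff (xi φ t y)).hasDerivAt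
    rw [← iteratedDeriv_succ] at h1
    exact HasDerivAt.comp (0 : ℝ) (h₂ := iteratedDeriv β (W.ρ 0)) (by rw [hx0]; exact h1) hx
  have hA : ∀ l, HasDerivAt
      (fun s : ℝ => mixedDeriv (α l) φ
        (Fin.cons (xi φ t (y + s • Pi.single i 1)) (y + s • Pi.single i 1))) _ 0 := fun l =>
    hφ.hasDerivAt_mixedDeriv_curve (α := α l) (i := i) (y := y)
      (by have := h.α_zero_le l; omega)
      (fun j => (Nat.add_le_add_right (h.succ_le l j) _).trans (hη j)) hx
  have hP := HasDerivAt.fun_finsetProd (u := Finset.univ) fun l _ => hA l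
  have hD : HasDerivAt (fun s : ℝ => mixedDeriv (unit 0) φ
      (Fin.cons (xi φ t (y + s • Pi.single i 1)) (y + s • Pi.single i 1))) _ 0 :=
    hφ.hasDerivAt_mixedDeriv_curve (α := unit 0) (i := i) (y := y)
      (by simp [unit]; omega) (fun j => by rw [unit_zero_succ, zero_add]; exact hi j) hx
  rw [hφ.partialDeriv_zero] at hp
  have hfin := ((hR.const_mul ((-1 : ℝ) ^ r)).mul hP).div (hD.pow r)
    (by simpa using pow_ne_zero r hp.ne')
  unfold HasLineDerivAt hFun
  rw [hφ.partialDeriv_zero]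
  simp only [add_zero]
  refine hfin.congr_deriv ?_
  simp only [zero_smul, add_zero, hFunDeriv, hFun, prod_mixedDeriv_update, Fin.prod_univ_succ,
    Fin.cons_zero, Fin.cons_succ, hφ.partialDeriv_zero, smul_eq_mul, Pi.pow_apply, Pi.mul_apply]
  set x : Fin (d + 1) → ℝ := Fin.cons (xi φ t y) y
  set p := mixedDeriv (unit 0) φ x
  set q := mixedDeriv (unit i.succ) φ x
  set R := iteratedDeriv β (W.ρ 0) (xi φ t y)
  set R₁ := iteratedDeriv (β + 1) (W.ρ 0) (xi φ t y)
  set P := ∏ l, mixedDeriv (α l) φ x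
  have hpne : p ≠ 0 := hp.ne'
  have hsplit : ∀ f g h k : Fin r → ℝ, ∑ l, ((f l + g l) + (h l + k l)) =
      ∑ l, (f l + g l) + ∑ l, (h l + k l) := fun f g h k => Finset.sum_add_distrib
  -- The power rule produces `p ^ (r - 1)`; the subtraction is genuine because `1 ≤ r`.
  have hpr : p ^ r = p ^ (r - 1) * p := by
    rw [← pow_succ, Nat.sub_add_cancel h.one_le]
  have hp1 : p ^ (r - 1) ≠ 0 := pow_ne_zero _ hpne
  rw [hsplit]
  have hS : ∑ l, ((-1) ^ r * R * (mixedDeriv (α l + unit i.succ) φ x *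
          ∏ m ∈ Finset.univ.erase l, mixedDeriv (α m) φ x) / p ^ r +
        (-1) ^ (r + 1) * R * (q * (mixedDeriv (α l + unit 0) φ x *
          ∏ m ∈ Finset.univ.erase l, mixedDeriv (α m) φ x)) / p ^ (r + 1)) =
      (-1) ^ r * R / p ^ r * ∑ l, (∏ m ∈ Finset.univ.erase l, mixedDeriv (α m) φ x) *
        (mixedDeriv (α l + unit 0) φ x * -(q / p) + mixedDeriv (α l + unit i.succ) φ x) := by
    rw [Finset.mul_sum]
    refine Finset.sum_congr rfl fun l _ => ?_
    rw [pow_succ, pow_succ]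
    field_simp
    ring
  rw [hS]
  generalize ∑ l, (∏ m ∈ Finset.univ.erase l, mixedDeriv (α m) φ x) *
    (mixedDeriv (α l + unit 0) φ x * -(q / p) + mixedDeriv (α l + unit i.succ) φ x) = S
  -- The summands coming from the denominator do not depend on `l`, so their sum is `r` times one of
  -- them.
  simp only [Finset.sum_const, Finset.card_univ, Fintype.card_fin, nsmul_eq_mul, pow_succ, hpr]
  field_simp
  ring

end Smooth

/-! ### Sums of a bounded number of functions -/

/-- On the set `U`, the function `G` is a sum of at most `n` functions with the property `P`. -/
def IsSumOf {X : Type*} (P : (X → ℝ) → Prop) (U : Set X) (n : ℕ) (G : X → ℝ) : Prop :=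
  ∃ (ι : Type) (_ : Fintype ι) (h : ι → X → ℝ), Fintype.card ι ≤ n ∧ (∀ j, P (h j)) ∧
    ∀ y ∈ U, G y = ∑ j, h j y

namespace IsSumOf

variable {X : Type*} {P : (X → ℝ) → Prop} {U : Set X}

theorem single {h : X → ℝ} (hP : P h) : IsSumOf P U 1 h :=
  ⟨Unit, inferInstance, fun _ => h, by simp, fun _ => hP, fun y _ => by simp⟩

theorem mono {n m : ℕ} {G : X → ℝ} (h : IsSumOf P U n G) (hnm : n ≤ m) : IsSumOf P U m G := by
  obtain ⟨ι, i, f, hc, hP, hG⟩ := h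
  exact ⟨ι, i, f, hc.trans hnm, hP, hG⟩

theorem add {n m : ℕ} {G H : X → ℝ} (hG : IsSumOf P U n G) (hH : IsSumOf P U m H) :
    IsSumOf P U (n + m) fun y => G y + H y := by
  obtain ⟨ι, _, f, hc, hP, hG⟩ := hG
  obtain ⟨κ, _, g, hc', hP', hH⟩ := hH
  refine ⟨ι ⊕ κ, inferInstance, Sum.elim f g, ?_, ?_, fun y hy => ?_⟩
  · rw [Fintype.card_sum]
    omega
  · rintro (j | j)
    · exact hP j
    · exact hP' j
  · simp [hG y hy, hH y hy]

theorem sum {κ : Type} [Fintype κ] {n : ℕ} {G : κ → X → ℝ} (h : ∀ k, IsSumOf P U n (G k)) :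
    IsSumOf P U (Fintype.card κ * n) fun y => ∑ k, G k y := by
  choose ι i f hc hP hG using h
  refine ⟨Σ k, ι k, inferInstance, fun j => f j.1 j.2, ?_, fun j => hP _ _, fun y hy => ?_⟩
  · rw [Fintype.card_sigma, ← smul_eq_mul, ← Finset.card_univ]
    exact Finset.sum_le_card_nsmul _ _ _ fun k _ => hc k
  · rw [Fintype.sum_sigma]
    exact Finset.sum_congr rfl fun k _ => hG k y hy

theorem congr {n : ℕ} {G H : X → ℝ} (h : IsSumOf P U n G) (hGH : ∀ y ∈ U, H y = G y) :
    IsSumOf P U n H := by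
  obtain ⟨ι, i, f, hc, hP, hG⟩ := h
  exact ⟨ι, i, f, hc, hP, fun y hy => (hGH y hy).trans (hG y hy)⟩

end IsSumOf

/-- `h` is one of the functions `h_{0,η}(t, ·)`. -/
def IsTerm {d : ℕ} (φ : (Fin (d + 1) → ℝ) → ℝ) (ρ₀ : ℝ → ℝ) (t : ℝ) (η : Fin d → ℕ)
    (h : (Fin d → ℝ) → ℝ) : Prop :=
  ∃ (r : ℕ) (α : Fin r → Fin (d + 1) → ℕ) (β : ℕ), Admissible 0 η r α β ∧
    h = hFun φ ρ₀ 0 r α β t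

/-- The bound `8^{k-1} (k-1)!` for the number of terms in a derivative of order `k`. -/
def termCount (k : ℕ) : ℕ := 8 ^ (k - 1) * (k - 1).factorial

/-! ### Derivatives of the preintegrated indicator. -/

section

variable {d : ℕ} {W : Weights (d + 1)} {ν : Fin d → ℕ} {φ : (Fin (d + 1) → ℝ) → ℝ}

/-- There are `1 + 4r` terms, and `r ≤ 2|η| - 1` gives at most `8|η| - 3`. -/
theorem isSumOf_hFunDeriv {ρ₀ : ℝ → ℝ} {t : ℝ} {η : Fin d → ℕ} {r : ℕ}
    {α : Fin r → Fin (d + 1) → ℕ} {β : ℕ} (h : Admissible 0 η r α β) (i : Fin d)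
    (U : Set (Fin d → ℝ)) :
    IsSumOf (IsTerm φ ρ₀ t (η + unit i)) U (8 * order η) (hFunDeriv φ ρ₀ r α β t i) := by
  have h4 := fun l : Fin r =>
    ((IsSumOf.single (P := IsTerm φ ρ₀ t (η + unit i)) (U := U)
      ⟨_, _, _, admissible_update_succ h i l, rfl⟩).add
      (.single ⟨_, _, _, admissible_cons_update_zero h i l, rfl⟩)).add
      ((IsSumOf.single (P := IsTerm φ ρ₀ t (η + unit i))
      ⟨_, _, _, admissible_cons_unit_add h i, rfl⟩).add
      (.single ⟨_, _, _, admissible_cons_cons h i, rfl⟩))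
  have h1 : IsSumOf (IsTerm φ ρ₀ t (η + unit i)) U 1 _ :=
    .single ⟨_, _, _, admissible_cons_unit h i, rfl⟩
  refine ((h1.add (.sum h4)).mono ?_).congr fun y _ => rfl
  have := h.r_le
  simp only [Fintype.card_fin]
  omega

theorem hasLineDerivAt_sum {n : ℕ} {ι : Type*} [Fintype ι] {h h' : ι → (Fin n → ℝ) → ℝ}
    {y e : Fin n → ℝ} (hd : ∀ j, HasLineDerivAt ℝ (h j) (h' j y) y e) :
    HasLineDerivAt ℝ (fun y => ∑ j, h j y) (∑ j, h' j y) y e :=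
  HasDerivAt.fun_sum fun j _ => hd j

theorem SmoothMonotone.exists_lineDeriv_isSumOf (hφ : SmoothMonotone W ν φ) {t : ℝ}
    {η : Fin d → ℕ} {i : Fin d} (hη : η + unit i ≤ ν) {n : ℕ} {G : (Fin d → ℝ) → ℝ}
    (hG : IsSumOf (IsTerm φ (W.ρ 0) t η) (levelDomain φ t) n G) :
    ∃ G', IsSumOf (IsTerm φ (W.ρ 0) t (η + unit i)) (levelDomain φ t) (n * (8 * order η)) G' ∧
      ∀ y ∈ levelDomain φ t, HasLineDerivAt ℝ G (G' y) y (Pi.single i 1) := by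
  obtain ⟨ι, _, h, hc, hP, hG⟩ := hG
  choose r α β hadm he using hP
  refine ⟨fun y => ∑ j, hFunDeriv φ (W.ρ 0) (r j) (α j) (β j) t i y,
    (IsSumOf.sum fun j => isSumOf_hFunDeriv (hadm j) i _).mono (Nat.mul_le_mul_right _ hc),
    fun y hy => ?_⟩
  refine (hasLineDerivAt_sum (h := h)
    (h' := fun j => hFunDeriv φ (W.ρ 0) (r j) (α j) (β j) t i) fun j => ?_).congr_of_eventuallyEq ?_
  · rw [he j]
    exact hφ.hasLineDerivAt_hFun hη (hadm j) hy
  · filter_upwards [(hφ.isOpen_levelDomain t).mem_nhds hy] with z hz using hG z hz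

theorem admissible_unit (i : Fin d) :
    Admissible 0 (unit i) 1 (fun _ => unit i.succ : Fin 1 → Fin (d + 1) → ℕ) 0 := by
  have ho : order (unit i) = 1 := by simpa [order] using order_add_unit 0 i
  exact
  { ne_zero := fun _ => unit_ne_zero _
    ne_unit := fun _ => unit_succ_ne_unit _
    r_le := by omega
    α_zero_le := fun _ => by rw [unit_succ_zero]; omega
    β_le := by omega
    sum_zero := by simp [unit_succ_zero]
    sum_succ := fun j => by simp [unit_succ_succ] }

theorem SmoothMonotone.hasLineDerivAt_distFun_xi (hφ : SmoothMonotone W ν φ) {i : Fin d}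
    (hi : unit i ≤ ν) {t : ℝ} {y : Fin d → ℝ} (hy : y ∈ levelDomain φ t) :
    HasLineDerivAt ℝ (preintegrate (W.ρ 0) (fun x => ind (t - φ x)))
      (hFun φ (W.ρ 0) 0 1 (fun _ => unit i.succ) 0 t y) y (Pi.single i 1) := by
  have h1 := (hasDerivAt_distFun (W.density 0) hφ.contDiff.continuous (xi φ t y))
  have h2 : HasLineDerivAt ℝ (fun z => distFun (W.ρ 0) (xi φ t z)) _ y (Pi.single i 1) :=
    HasDerivAt.comp (0 : ℝ) (h₂ := distFun (W.ρ 0)) (by simpa using h1) (hφ.hasDerivAt_xi hi hy)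
  have h3 := h2.congr_of_eventuallyEq (f₁ := preintegrate (W.ρ 0) (fun x => ind (t - φ x))) (by
    filter_upwards [(hφ.isOpen_levelDomain t).mem_nhds hy] with z hz
    exact preintegrate_ind_of_mem _ hφ.strictMono hz)
  have e : hFun φ (W.ρ 0) 0 1 (fun _ => unit i.succ) 0 t y = W.ρ 0 (xi φ t y) *
      -(mixedDeriv (unit i.succ) φ (Fin.cons (xi φ t y) y) /
        mixedDeriv (unit 0) φ (Fin.cons (xi φ t y) y)) := by
    simp [hFun, hφ.partialDeriv_zero]
    ring
  rw [e]
  exact h3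

/-- `G` is the `η`-th derivative of the preintegrated indicator, written as a sum of terms. -/
structure IsTermDeriv (φ : (Fin (d + 1) → ℝ) → ℝ) (ρ₀ : ℝ → ℝ) (t : ℝ) (η : Fin d → ℕ)
    (G : (Fin d → ℝ) → ℝ) : Prop where
  continuous : Continuous G
  eq_zero : ∀ y ∉ levelDomain φ t, G y = 0
  weak : HasWeakDeriv η (preintegrate ρ₀ (fun x => ind (t - φ x))) G
  eq_self : η = 0 → G = preintegrate ρ₀ (fun x => ind (t - φ x))
  isSumOf : η ≠ 0 → IsSumOf (IsTerm φ ρ₀ t η) (levelDomain φ t) (termCount (order η)) G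

theorem order_pos {n : ℕ} {η : Fin n → ℕ} (h : η ≠ 0) : 0 < order η := by
  obtain ⟨i, hi⟩ := Function.ne_iff.1 h
  exact (Nat.pos_of_ne_zero hi).trans_le
    (Finset.single_le_sum (f := η) (fun _ _ => Nat.zero_le _) (Finset.mem_univ i))

/-- The recursion for the number of terms. It fails at `k = 0`, so the induction on terms starts
from first derivatives. -/
theorem termCount_succ {k : ℕ} (hk : 0 < k) : termCount k * (8 * k) = termCount (k + 1) := by
  obtain ⟨m, rfl⟩ := Nat.exists_eq_succ_of_ne_zero hk.ne'
  simp only [termCount, Nat.succ_eq_add_one, Nat.add_sub_cancel, pow_succ, Nat.factorial_succ]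
  ring

/-- The derivative is computed termwise on `U_t` and extended by zero. The boundary condition at
order `η + eᵢ` makes the extension continuous, and then it is the derivative of `G` on all of `ℝ^d`.
-/
theorem SmoothMonotone.exists_isTermDeriv_step (hφ : SmoothMonotone W ν φ) {a b : ℝ}
    {B : (Fin d → ℕ) → ℝ≥0} (hB : ∀ η ≤ ν, η ≠ 0 → HCondition W φ a b 0 η (B η)) {t : ℝ}
    (ht : t ∈ Set.Icc a b) {η : Fin d → ℕ} {i : Fin d} (hη : η + unit i ≤ ν)
    {G : (Fin d → ℝ) → ℝ} (hG : IsTermDeriv φ (W.ρ 0) t η G) :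
    ∃ G', IsTermDeriv φ (W.ρ 0) t (η + unit i) G' ∧
      ∀ y, HasLineDerivAt ℝ G (G' y) y (Pi.single i 1) := by
  have hU := hφ.isOpen_levelDomain t
  have hne := add_unit_ne_zero η i
  obtain ⟨H, hH, hHd⟩ : ∃ H, IsSumOf (IsTerm φ (W.ρ 0) t (η + unit i)) (levelDomain φ t)
      (termCount (order (η + unit i))) H ∧
      ∀ y ∈ levelDomain φ t, HasLineDerivAt ℝ G (H y) y (Pi.single i 1) := by
    -- At order zero `G` is `Φ₀ ∘ ξ`, which is not handled as a sum of terms; its derivative is the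
    -- single term with `r = 1`, `β = 0`.
    by_cases h0 : η = 0
    · subst h0
      rw [hG.eq_self rfl, zero_add]
      rw [zero_add] at hη
      refine ⟨_, (IsSumOf.single ⟨_, _, _, admissible_unit i, rfl⟩).mono ?_,
        fun y hy => hφ.hasLineDerivAt_distFun_xi hη hy⟩
      exact Nat.succ_le_of_lt (by unfold termCount; positivity)
    · obtain ⟨H, hH, hHd⟩ := hφ.exists_lineDeriv_isSumOf hη (hG.isSumOf h0)
      refine ⟨H, ?_, hHd⟩
      rwa [order_add_unit, ← termCount_succ (order_pos h0)]
  obtain ⟨ι, _, h, hc, hP, hs⟩ := hH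
  set G' := (levelDomain φ t).indicator H
  have hin : ∀ y ∈ levelDomain φ t, G' y = H y := fun y hy => Set.indicator_of_mem hy _
  have hout : ∀ y ∉ levelDomain φ t, G' y = 0 := fun y hy => Set.indicator_of_notMem hy _
  have hG' : Continuous G' := by
    refine continuous_of_extend_zero hU ?_ hout fun z hz => ?_
    · refine ContinuousOn.congr (f := fun y => ∑ j, h j y)
        (continuousOn_finsetSum _ fun j _ => ?_) fun y hy => (hin y hy).trans (hs y hy)
      obtain ⟨r, α, β, hadm, he⟩ := hP j
      rw [he]
      exact hφ.continuousOn_hFun hη hadm t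
    · have : Tendsto (fun y => ∑ j, h j y) (𝓝[levelDomain φ t] z) (𝓝 (∑ _j : ι, 0)) := by
        refine tendsto_finsetSum _ fun j _ => ?_
        obtain ⟨r, α, β, hadm, he⟩ := hP j
        rw [he]
        exact (hB _ hη hne).tendsto_boundary r α β hadm t ht z hz
      rw [Finset.sum_const_zero] at this
      refine this.congr' ?_
      filter_upwards [self_mem_nhdsWithin] with y hy using ((hin y hy).trans (hs y hy)).symm
  have hd := hasLineDerivAt_of_extend_zero hU hG.continuous hG' hG.eq_zero hout
    fun y hy => by rw [hin y hy]; exact hHd y hy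
  refine ⟨G', ⟨hG', hout, hG.weak.add_unit hG.continuous hG' hd, fun h => absurd h hne, fun _ => ?_⟩,
    hd⟩
  exact ⟨ι, _, h, hc, hP, fun y hy => (hin y hy).trans (hs y hy)⟩

theorem SmoothMonotone.exists_isTermDeriv (hφ : SmoothMonotone W ν φ) {a b : ℝ}
    {B : (Fin d → ℕ) → ℝ≥0} (hB : ∀ η ≤ ν, η ≠ 0 → HCondition W φ a b 0 η (B η)) {t : ℝ}
    (ht : t ∈ Set.Icc a b) (η : Fin d → ℕ) (hη : η ≤ ν) :
    ∃ G, IsTermDeriv φ (W.ρ 0) t η G := by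
  induction hk : order η generalizing η with
  | zero =>
    have h0 : η = 0 := by
      by_contra h
      exact (order_pos h).ne' hk
    subst h0
    have hc := continuous_preintegrate_ind (t := t) (W.density 0) hφ.continuous hφ.strictMono
      hφ.tendsto_atTop
    exact ⟨_, hc, fun y hy => preintegrate_ind_of_notMem _ hφ.continuous hφ.tendsto_atTop hy,
      hasWeakDeriv_zero hc, fun _ => rfl, fun h => absurd rfl h⟩
  | succ k ih =>
    have h0 : η ≠ 0 := by
      rintro rfl
      simp [order] at hk
    obtain ⟨i, hi⟩ := Function.ne_iff.1 h0
    have hle : unit i ≤ η := by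
      intro j
      by_cases h : j = i
      · subst h
        simpa [unit] using Nat.one_le_iff_ne_zero.2 hi
      · simp [unit, h]
    obtain ⟨η', rfl⟩ : ∃ η', η = η' + unit i := ⟨η - unit i, (tsub_add_cancel_of_le hle).symm⟩
    rw [order_add_unit] at hk
    obtain ⟨G, hG⟩ := ih η' (le_trans (by simp) hη) (by omega)
    obtain ⟨G', hG', -⟩ := hφ.exists_isTermDeriv_step hB ht hη hG
    exact ⟨G', hG'⟩

/-- The functions `G η` are chosen independently of each other, and uniqueness of continuous weak
derivatives links them into one family of classical derivatives, independent of the order of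
differentiation. -/
theorem SmoothMonotone.isTermDeriv_mixedDeriv (hφ : SmoothMonotone W ν φ) {a b : ℝ}
    {B : (Fin d → ℕ) → ℝ≥0} (hB : ∀ η ≤ ν, η ≠ 0 → HCondition W φ a b 0 η (B η)) {t : ℝ}
    (ht : t ∈ Set.Icc a b) :
    (∀ η ≤ ν, IsTermDeriv φ (W.ρ 0) t η
      (mixedDeriv η (preintegrate (W.ρ 0) (fun x => ind (t - φ x))))) ∧
    preintegrate (W.ρ 0) (fun x => ind (t - φ x)) ∈ mixedC ν := by
  have hex : ∀ η : Fin d → ℕ, ∃ G, η ≤ ν → IsTermDeriv φ (W.ρ 0) t η G := fun η => by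
    by_cases h : η ≤ ν
    · obtain ⟨G, hG⟩ := hφ.exists_isTermDeriv hB ht η h
      exact ⟨G, fun _ => hG⟩
    · exact ⟨0, fun h' => absurd h' h⟩
  choose G hG using hex
  have hd : ∀ (η : Fin d → ℕ) (i : Fin d), η + unit i ≤ ν →
      ∀ y, HasLineDerivAt ℝ (G η) (G (η + unit i) y) y (Pi.single i 1) := fun η i hη => by
    obtain ⟨G', hG', hd⟩ := hφ.exists_isTermDeriv_step hB ht hη (hG η (le_trans (by simp) hη))
    -- The derivative of `G η` and the chosen `G (η + unit i)` are continuous weak derivatives of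
    -- the same order, hence equal.
    rwa [hG'.weak.eq_of_continuous (hG _ hη).weak hG'.continuous (hG _ hη).continuous] at hd
  have h0 := (hG 0 (fun i => Nat.zero_le _)).eq_self rfl
  have hm : ∀ η ≤ ν, mixedDeriv η (preintegrate (W.ρ 0) (fun x => ind (t - φ x))) = G η :=
    fun η hη => by rw [← h0]; exact mixedDeriv_eq_family hd hη
  refine ⟨fun η hη => (hm η hη).symm ▸ hG η hη,
    fun η hη => (hm η hη).symm ▸ (hG η hη).continuous, fun η i hη => ?_⟩
  rw [hm η (le_trans (by simp) hη), hm _ hη]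
  exact hd η i hη

/-! ### Energy bounds -/

theorem Weights.weight_nonneg {n : ℕ} (W : Weights n) (η : Fin n → ℕ) (y : Fin n → ℝ) :
    0 ≤ W.weight η y := by
  refine Finset.prod_nonneg fun i _ => ?_
  split_ifs
  · exact (W.density i).nonneg _
  · exact (W.ψ_pos i _).le

theorem Weights.integrable_weight {n : ℕ} (W : Weights n) (η : Fin n → ℕ) :
    Integrable (W.weight η) := by
  have := Integrable.fintype_prod (ι := Fin n) (μ := fun _ => (volume : Measure ℝ))
    (f := fun i x => if η i = 0 then W.ρ i x else W.ψ i x) fun i => by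
      split_ifs
      · exact (W.density i).integrable
      · exact W.ψ_integrable i
  exact this

theorem Weights.lintegral_weight_zero {n : ℕ} (W : Weights n) :
    ∫⁻ y, ENNReal.ofReal (W.weight 0 y) = 1 := by
  rw [← ofReal_integral_eq_lintegral_ofReal (W.integrable_weight 0)
    (Eventually.of_forall (W.weight_nonneg 0))]
  have : ∫ y, W.weight 0 y = 1 := by
    simp only [Weights.weight, Pi.zero_apply, if_true]
    rw [integral_fintype_prod_volume_eq_prod]
    exact Finset.prod_eq_one fun i _ => (W.density i).integral_eq_one
  rw [this, ENNReal.ofReal_one]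

theorem Weights.energy_zero_le_one {n : ℕ} (W : Weights n) {A : Set (Fin n → ℝ)}
    {f : (Fin n → ℝ) → ℝ} (hf : ∀ y, |f y| ≤ 1) : W.energy 0 A f ≤ 1 := by
  rw [← W.lintegral_weight_zero]
  refine (setLIntegral_le_lintegral _ _).trans (lintegral_mono fun y => ENNReal.ofReal_le_ofReal ?_)
  exact mul_le_of_le_one_left (W.weight_nonneg 0 y) (pow_le_one₀ (abs_nonneg _) (hf y))

theorem Weights.energy_univ_eq {n : ℕ} (W : Weights n) {η : Fin n → ℕ} {U : Set (Fin n → ℝ)}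
    (hU : MeasurableSet U) {G : (Fin n → ℝ) → ℝ} (h0 : ∀ y ∉ U, G y = 0) :
    W.energy η Set.univ G = W.energy η U G := by
  unfold Weights.energy
  rw [Measure.restrict_univ, ← lintegral_indicator hU]
  refine lintegral_congr fun y => ?_
  by_cases hy : y ∈ U
  · rw [Set.indicator_of_mem hy]
  · rw [Set.indicator_of_notMem hy, h0 y hy]
    simp

/-- Cauchy–Schwarz gives `|∑ h_j|² ≤ N ∑ |h_j|²` pointwise; the second factor `N` comes from summing
the `N` energy bounds. -/
theorem Weights.energy_sum_le {n : ℕ} (W : Weights n) {η : Fin n → ℕ} {U : Set (Fin n → ℝ)}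
    (hU : MeasurableSet U) {ι : Type*} [Fintype ι] {h : ι → (Fin n → ℝ) → ℝ}
    (hc : ∀ j, ContinuousOn (h j) U) {G : (Fin n → ℝ) → ℝ} (hG : ∀ y ∈ U, G y = ∑ j, h j y)
    {B : ℝ≥0∞} (hB : ∀ j, W.energy η U (h j) ≤ B) :
    W.energy η U G ≤ (Fintype.card ι : ℝ≥0∞) ^ 2 * B := by
  have hpt : ∀ y ∈ U, ENNReal.ofReal (|G y| ^ 2 * W.weight η y) ≤
      (Fintype.card ι : ℝ≥0∞) * ∑ j, ENNReal.ofReal (|h j y| ^ 2 * W.weight η y) := fun y hy => by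
    rw [← ENNReal.ofReal_sum_of_nonneg fun j _ =>
      mul_nonneg (by positivity) (W.weight_nonneg η y), ← ENNReal.ofReal_natCast,
      ← ENNReal.ofReal_mul (by positivity)]
    refine ENNReal.ofReal_le_ofReal ?_
    rw [← Finset.sum_mul, ← mul_assoc]
    refine mul_le_mul_of_nonneg_right ?_ (W.weight_nonneg η y)
    rw [hG y hy]
    simp only [sq_abs]
    exact sq_sum_le_card_mul_sum_sq
  calc W.energy η U G
      ≤ ∫⁻ y in U, (Fintype.card ι : ℝ≥0∞) *
          ∑ j, ENNReal.ofReal (|h j y| ^ 2 * W.weight η y) := setLIntegral_mono' hU hpt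
    _ = (Fintype.card ι : ℝ≥0∞) * ∑ j, W.energy η U (h j) := by
      rw [lintegral_const_mul' _ _ (ENNReal.natCast_ne_top _), lintegral_finsetSum']
      · rfl
      · intro j _
        refine AEMeasurable.ennreal_ofReal (AEMeasurable.mul ?_ ?_)
        · exact (((hc j).abs).pow 2).aemeasurable hU
        · exact (W.integrable_weight η).aemeasurable.restrict
    _ ≤ (Fintype.card ι : ℝ≥0∞) * ∑ _j : ι, B := by gcongr with j; exact hB j
    _ = (Fintype.card ι : ℝ≥0∞) ^ 2 * B := by
      rw [Finset.sum_const, Finset.card_univ, nsmul_eq_mul, sq, mul_assoc]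

theorem SmoothMonotone.derivEnergy_le (hφ : SmoothMonotone W ν φ) {a b : ℝ} {B : ℝ≥0}
    {η : Fin d → ℕ} (hη : η ≤ ν) (hne : η ≠ 0) (hB : HCondition W φ a b 0 η B) {t : ℝ}
    (ht : t ∈ Set.Icc a b) {G : (Fin d → ℝ) → ℝ} (hG : IsTermDeriv φ (W.ρ 0) t η G) :
    W.tail.derivEnergy η (preintegrate (W.ρ 0) (fun x => ind (t - φ x))) ≤
      ENNReal.ofReal (((8 : ℝ) ^ (order η - 1) * ((order η - 1).factorial : ℝ)) ^ 2 * B) := by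
  have hU := (hφ.isOpen_levelDomain t).measurableSet
  obtain ⟨ι, _, h, hc, hP, hs⟩ := hG.isSumOf hne
  rw [W.tail.derivEnergy_eq hG.weak, W.tail.energy_univ_eq hU hG.eq_zero]
  refine (W.tail.energy_sum_le hU (fun j => ?_) hs (B := B) fun j => ?_).trans ?_
  · obtain ⟨r, α, β, hadm, he⟩ := hP j
    rw [he]
    exact hφ.continuousOn_hFun hη hadm t
  · obtain ⟨r, α, β, hadm, he⟩ := hP j
    rw [he]
    exact (le_iSup₂ (f := fun t (_ : t ∈ Set.Icc a b) =>
      W.tail.energy η (levelDomain φ t) (hFun φ (W.ρ 0) 0 r α β t)) t ht).trans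
      (hB.integral_le r α β hadm)
  · have e : ((8 : ℝ) ^ (order η - 1) * ((order η - 1).factorial : ℝ)) =
        (termCount (order η) : ℝ) := by simp [termCount]
    rw [e, ENNReal.ofReal_mul (by positivity), ENNReal.ofReal_coe_nnreal,
      ENNReal.ofReal_pow (by positivity), ENNReal.ofReal_natCast]
    gcongr

theorem SmoothMonotone.sobolevNorm_le (hφ : SmoothMonotone W ν φ) {a b : ℝ}
    {B : (Fin d → ℕ) → ℝ≥0} (hB : ∀ η ≤ ν, η ≠ 0 → HCondition W φ a b 0 η (B η)) {t : ℝ}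
    (ht : t ∈ Set.Icc a b) :
    W.tail.sobolevNorm ν (preintegrate (W.ρ 0) (fun x => ind (t - φ x))) ≤
      ENNReal.ofReal (√(1 + ∑ η ∈ (Finset.Iic ν).erase 0,
        ((8 : ℝ) ^ (order η - 1) * ((order η - 1).factorial : ℝ)) ^ 2 * (B η : ℝ) /
          W.tail.γ (supp η))) := by
  have hnn : ∀ η : Fin d → ℕ, 0 ≤ ((8 : ℝ) ^ (order η - 1) * ((order η - 1).factorial : ℝ)) ^ 2 *
      (B η : ℝ) / W.tail.γ (supp η) := fun η => by
    have := W.tail.γ_pos (supp η)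
    positivity
  have hsum := Finset.sum_nonneg fun η (_ : η ∈ (Finset.Iic ν).erase 0) => hnn η
  rw [Real.sqrt_eq_rpow, ← ENNReal.ofReal_rpow_of_nonneg (by positivity) (by norm_num),
    Weights.sobolevNorm]
  refine ENNReal.rpow_le_rpow ?_ (by norm_num)
  have hder := (hφ.isTermDeriv_mixedDeriv hB ht).1
  have h0 : (0 : Fin d → ℕ) ∈ Finset.Iic ν := Finset.mem_Iic.2 fun i => Nat.zero_le _
  -- The index `η = 0` is split off: it yields the summand `1`, the remaining ones the sum over `η ≠
  -- 0`.
  rw [← Finset.add_sum_erase _ _ h0, ENNReal.ofReal_add zero_le_one hsum,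
    ENNReal.ofReal_sum_of_nonneg fun η _ => hnn η]
  refine add_le_add ?_ (Finset.sum_le_sum fun η hη => ?_)
  · have hs : supp (0 : Fin d → ℕ) = ∅ := by simp [supp]
    rw [hs, W.tail.γ_empty, div_one, ENNReal.ofReal_one, one_mul,
      W.tail.derivEnergy_eq (hder 0 (Finset.mem_Iic.1 h0)).weak,
      (hder 0 (Finset.mem_Iic.1 h0)).eq_self rfl]
    exact W.tail.energy_zero_le_one (abs_preintegrate_ind_le_one (W.density 0) hφ.continuous
      hφ.strictMono hφ.tendsto_atTop)
  · rw [Finset.mem_erase, Finset.mem_Iic] at hη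
    refine (mul_le_mul_right (hφ.derivEnergy_le hη.2 hη.1 (hB η hη.2 hη.1) ht (hder η hη.2)) _).trans
      (le_of_eq ?_)
    rw [← ENNReal.ofReal_mul (by have := W.tail.γ_pos (supp η); positivity)]
    congr 1
    ring

end

end Preint

end

theorem theorem3 {d : ℕ} (hd : 1 ≤ d) (W : Preint.Weights (d + 1)) (ν : Fin d → ℕ)
    (a b : ℝ) (hab : a ≤ b) (φ : (Fin (d + 1) → ℝ) → ℝ)
    (hφ : Preint.SmoothMonotone W ν φ)
    (B : (Fin d → ℕ) → ℝ≥0)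
    (hB : ∀ η ≤ ν, η ≠ 0 → Preint.HCondition W φ a b 0 η (B η)) :
    (∀ t ∈ Set.Icc a b,
      (∀ y ∈ Preint.levelDomain φ t,
        Preint.preintegrate (W.ρ 0) (fun x => Preint.ind (t - φ x)) y =
          Preint.distFun (W.ρ 0) (Preint.xi φ t y)) ∧
      (∀ y ∉ Preint.levelDomain φ t,
        Preint.preintegrate (W.ρ 0) (fun x => Preint.ind (t - φ x)) y = 0) ∧
      Preint.preintegrate (W.ρ 0) (fun x => Preint.ind (t - φ x)) ∈
        W.tail.sobolev ν ∩ Preint.mixedC ν) ∧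
    (⨆ t ∈ Set.Icc a b,
        W.tail.sobolevNorm ν (Preint.preintegrate (W.ρ 0) (fun x => Preint.ind (t - φ x)))) ≤
      ENNReal.ofReal (√(1 + ∑ η ∈ (Finset.Iic ν).erase 0,
        ((8 : ℝ) ^ (Preint.order η - 1) * ((Preint.order η - 1).factorial : ℝ)) ^ 2 * (B η : ℝ) /
          W.tail.γ (Preint.supp η))) := by
  refine ⟨fun t ht => ⟨fun y hy => Preint.preintegrate_ind_of_mem _ hφ.strictMono hy,
    fun y hy => Preint.preintegrate_ind_of_notMem _ hφ.continuous hφ.tendsto_atTop hy,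
    ⟨?_, (hφ.sobolevNorm_le hB ht).trans_lt ENNReal.ofReal_lt_top⟩,
    (hφ.isTermDeriv_mixedDeriv hB ht).2⟩, iSup₂_le fun t ht => hφ.sobolevNorm_le hB ht⟩
  exact (Preint.continuous_preintegrate_ind (W.density 0) hφ.continuous hφ.strictMono
    hφ.tendsto_atTop).locallyIntegrable
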